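/- For partitions $\kappa,\lambda$ of $n$ write $\lambda\trianglelefteq\kappa$ if $\lambda_1+\dots+\lambda_k\le\kappa_1+\dots+\kappa_k$ for all $k$, let $\rho_\kappa=\sum_i\kappa_i(\kappa_i-i)$, and let $M_\lambda$ be the monomial symmetric polynomial in $y_1,\dots,y_m$. The zonal polynomials $\mathcal C_\kappa(y_1,\dots,y_m)$, for $\kappa$ a partition of $n$, are the unique family of polynomials of the form $$\mathcal C_\kappa=\sum_{\lambda\trianglelefteq\kappa}c_{\kappa,\lambda}M_\lambda$$ that satisfy $\sum_{\kappa}\mathcal C_\kappa=(y_1+\dots+y_m)^n$ and, for every $\kappa$, $$\sum_{i=1}^m\Bigl(y_i^2\frac{\partial^2}{\partial y_i^2}+\sum_{j\ne i}\frac{y_i^2}{y_i-y_j}\frac{\partial}{\partial y_i}\Bigr)\mathcal C_\kappa=\bigl(\rho_\kappa+(m-1)n\bigr)\mathcal C_\kappa .$$ Here $c_{\kappa,\lambda}$, the coefficient of $M_\lambda$ in $\mathcal C_\kappa$, is considered in any number $m$ of variables that is at least the number of parts of $\lambda$, and $c_{\kappa,\lambda}=0$ if $\lambda\not\trianglelefteq\kappa$.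 **Theorem.** The following hold for every such $m$: - $c_{(n-1,1),(n-1,1)}=\dfrac{2n(n-1)}{2n-1}$ for $n\ge2$; - $c_{(n-1,1),(n-2,2)}=\dfrac{2n(n-1)(n-2)}{(2n-1)(2n-5)}$ for $n\ge4$; - $c_{(n-2,2),(n-2,2)}=\dfrac{2n(n-1)(n-2)(n-3)}{(2n-3)(2n-5)}$ for $n\ge4$. Moreover, for $n\ge6$ and $\kappa,\lambda$ among the partitions $(n)$, $(n-1,1)$, $(n-2,2)$, $(n-2,1,1)$, $(n-3,3)$, $(n-3,2,1)$, the coefficients $c_{\kappa,\lambda}$ are as follows. - $\kappa=(n)$: in this order of $\lambda$, they are $1$, $\frac{n}{2n-1}$, $\frac{3(n-1)n}{2(2n-3)(2n-1)}$, $\frac{(n-1)n}{(2n-3)(2n-1)}$, $\frac{5(n-2)(n-1)n}{2(2n-5)(2n-3)(2n-1)}$, $\frac{3(n-2)(n-1)n}{2(2n-5)(2n-3)(2n-1)}$. - $\kappa=(n-1,1)$: $0$, $\frac{2(n-1)n}{2n-1}$, $\frac{2(n-2)(n-1)n}{(2n-5)(2n-1)}$, $\frac{2n(2n^2-6n+3)}{(2n-5)(2n-1)}$,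 $\frac{3(n-3)(n-2)(n-1)n}{(2n-7)(2n-5)(2n-1)}$, $\frac{(n-2)n(5n^2-20n+11)}{(2n-7)(2n-5)(2n-1)}$. - $\kappa=(n-2,2)$: $0$, $0$, $\frac{2(n-3)(n-2)(n-1)n}{(2n-5)(2n-3)}$, $\frac{4(n-3)(n-2)(n-1)n}{3(2n-5)(2n-3)}$, $\frac{2(n-4)(n-3)(n-2)(n-1)n}{(2n-9)(2n-5)(2n-3)}$, $\frac{2(n-3)(n-1)n(5n^2-30n+36)}{3(2n-9)(2n-5)(2n-3)}$. - $\kappa=(n-2,1,1)$: $0$, $0$, $0$, $\frac23(n-2)n$, $0$, $\frac{2(n-3)(n-2)n}{3(2n-7)}$. - $\kappa=(n-3,3)$: $0$, $0$, $0$, $0$, $\frac{4(n-5)(n-4)(n-3)(n-2)(n-1)n}{3(2n-9)(2n-7)(2n-5)}$, $\frac{4(n-5)(n-4)(n-3)(n-2)(n-1)n}{5(2n-9)(2n-7)(2n-5)}$. - $\kappa=(n-3,2,1)$: $0$, $0$, $0$, $0$, $0$, $\frac{4(n-4)(n-3)(n-1)n}{5(2n-7)}$. -/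

import Mathlib

open MvPolynomial

noncomputable section

namespace Zonal

/-- The parts `λ₁ ≥ λ₂ ≥ ⋯` of a partition `λ`, indexed from `0` (`part p i` is `λ_{i+1}`),
and continued by zeros. -/
def part {n : ℕ} (p : n.Partition) (i : ℕ) : ℕ :=
  (p.parts.sort (fun a b => b ≤ a)).getD i 0

/-- `ρ_λ = ∑ λᵢ (λᵢ - i)`, the sum being over the parts of `λ`, numbered from `1`. -/
def rho {n : ℕ} (p : n.Partition) : ℝ :=
  ∑ i ∈ Finset.range p.parts.card, (part p i : ℝ) * ((part p i : ℝ) - ((i : ℝ) + 1))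

/-- The dominance order: `λ ⊴ κ` iff `λ₁ + ⋯ + λ_k ≤ κ₁ + ⋯ + κ_k` for all `k`. -/
def Dominates {n : ℕ} (κ l : n.Partition) : Prop :=
  ∀ k : ℕ, ∑ i ∈ Finset.range k, part l i ≤ ∑ i ∈ Finset.range k, part κ i

/-- The radial Laplace-Beltrami operator on positive definite matrices, without its Euler part,
`Δ_Y = ∑ᵢ (yᵢ² ∂ᵢ² + ∑_{j ≠ i} yᵢ² / (yᵢ - yⱼ) ∂ᵢ)`, applied to a polynomial and
evaluated at a point `y` (with pairwise distinct coordinates). -/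
def laplaceBeltrami {m : ℕ} (f : MvPolynomial (Fin m) ℝ) (y : Fin m → ℝ) : ℝ :=
  ∑ i, (y i ^ 2 * eval y (pderiv i (pderiv i f)) +
    ∑ j ∈ Finset.univ.erase i, y i ^ 2 / (y i - y j) * eval y (pderiv i f))

/-- `C` is the family of the zonal polynomials `C_κ(y₁, …, y_m)`, `κ` a partition of `n`:
each `C_κ` is a linear combination of monomial symmetric polynomials `M_λ` with `λ ⊴ κ`,
it is an eigenfunction of `Δ_Y` for the eigenvalue `ρ_κ + (m - 1) n`, and the `C_κ` add up to
`(y₁ + ⋯ + y_m) ^ n`. These conditions determine the family: `λ ⊴ κ` and `λ ≠ κ` imply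
`ρ_λ < ρ_κ`, so that the first two fix each `C_κ` up to a scalar, and the third fixes
the scalars. -/
structure IsZonalFamily (m n : ℕ) (C : n.Partition → MvPolynomial (Fin m) ℝ) : Prop where
  mem_span : ∀ κ, C κ ∈ Submodule.span ℝ (msymm (Fin m) ℝ '' {l : n.Partition | Dominates κ l})
  eigen : ∀ κ, ∀ y : Fin m → ℝ, Function.Injective y →
    laplaceBeltrami (C κ) y = (rho κ + ((m : ℝ) - 1) * n) * eval y (C κ)
  sum_eq : ∑ κ, C κ = (∑ i, X i) ^ n

/-- The zonal polynomial `C_κ(y₁, …, y_m)`, a member of the unique zonal family. -/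
def zonalPoly (m : ℕ) {n : ℕ} (κ : n.Partition) : MvPolynomial (Fin m) ℝ :=
  Classical.epsilon (IsZonalFamily m n) κ

/-- The coefficient `c_{κ,λ}` of `M_λ` in `C_κ(y₁, …, y_m)`, where `λ` has at most `m` parts.
As distinct monomial symmetric polynomials have no monomial in common, it is the coefficient
of the monomial `y₁^λ₁ ⋯ y_m^λ_m`. -/
def zonalCoeff (m : ℕ) {n : ℕ} (κ l : n.Partition) : ℝ :=
  coeff (Finsupp.equivFunOnFinite.symm fun i : Fin m => part l i) (zonalPoly m κ)

/-- The parts of `(n), (n-1,1), (n-2,2), (n-2,1,1), (n-3,3), (n-3,2,1)`. -/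
def cornerParts (n : ℕ) : Fin 6 → Multiset ℕ :=
  ![{n}, {n - 1, 1}, {n - 2, 2}, {n - 2, 1, 1}, {n - 3, 3}, {n - 3, 2, 1}]

/-- The closed forms of the coefficients in the upper left corner; row and column `i` belong to
`cornerParts n i`. -/
def cornerTable (n : ℝ) : Matrix (Fin 6) (Fin 6) ℝ :=
  !![1,
      n / (2 * n - 1),
      3 * (n - 1) * n / (2 * (2 * n - 3) * (2 * n - 1)),
      (n - 1) * n / ((2 * n - 3) * (2 * n - 1)),
      5 * (n - 2) * (n - 1) * n / (2 * (2 * n - 5) * (2 * n - 3) * (2 * n - 1)),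
      3 * (n - 2) * (n - 1) * n / (2 * (2 * n - 5) * (2 * n - 3) * (2 * n - 1));
    0,
      2 * (n - 1) * n / (2 * n - 1),
      2 * (n - 2) * (n - 1) * n / ((2 * n - 5) * (2 * n - 1)),
      2 * n * (2 * n ^ 2 - 6 * n + 3) / ((2 * n - 5) * (2 * n - 1)),
      3 * (n - 3) * (n - 2) * (n - 1) * n / ((2 * n - 7) * (2 * n - 5) * (2 * n - 1)),
      (n - 2) * n * (5 * n ^ 2 - 20 * n + 11) / ((2 * n - 7) * (2 * n - 5) * (2 * n - 1));
    0, 0,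
      2 * (n - 3) * (n - 2) * (n - 1) * n / ((2 * n - 5) * (2 * n - 3)),
      4 * (n - 3) * (n - 2) * (n - 1) * n / (3 * (2 * n - 5) * (2 * n - 3)),
      2 * (n - 4) * (n - 3) * (n - 2) * (n - 1) * n / ((2 * n - 9) * (2 * n - 5) * (2 * n - 3)),
      2 * (n - 3) * (n - 1) * n * (5 * n ^ 2 - 30 * n + 36) /
        (3 * (2 * n - 9) * (2 * n - 5) * (2 * n - 3));
    0, 0, 0,
      2 / 3 * (n - 2) * n,
      0,
      2 * (n - 3) * (n - 2) * n / (3 * (2 * n - 7));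
    0, 0, 0, 0,
      4 * (n - 5) * (n - 4) * (n - 3) * (n - 2) * (n - 1) * n /
        (3 * (2 * n - 9) * (2 * n - 7) * (2 * n - 5)),
      4 * (n - 5) * (n - 4) * (n - 3) * (n - 2) * (n - 1) * n /
        (5 * (2 * n - 9) * (2 * n - 7) * (2 * n - 5));
    0, 0, 0, 0, 0,
      4 * (n - 4) * (n - 3) * (n - 1) * n / (5 * (2 * n - 7))]

end Zonal

end

/-! Write `C_κ = ∑ c_{κ,λ} M_λ`. For `i < j` the two first-order terms of the operator combine to
`(yᵢ² ∂ᵢf - yⱼ² ∂ⱼf) / (yᵢ - yⱼ)`, which is a polynomial when `f` is symmetric. Reading off the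
coefficient of `y^λ` turns the eigenvalue equation into `(ρ_κ - ρ_λ) c_{κ,λ} = ∑_{i<j} ∑_{t=1}^{λⱼ}
(λᵢ - λⱼ + 2t) c_{κ,μ}`, where `μ` is `λ` with `t` units moved from part `j` to part `i`, then
sorted (`coeff_dividedDifference`, `exists_laplaceBeltrami`, `eigen_iff`). The number `m` of
variables has dropped out: it enters only through the common summand `(m - 1) n` of the eigenvalues.

Every such `μ` strictly dominates `λ` (`dominates_of_shape_move`), and `ρ` strictly increases along
dominance (`Dominates.rho_lt`). Hence the system is triangular: for `κ ≠ λ` with `λ ⊴ κ`, the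
recurrence gives `c_{κ,λ}` from earlier columns, and the diagonal entry follows from `∑_κ c_{κ,λ} =
n! / ∏ λᵢ!`, the coefficient of `y^λ` in `(y₁ + ⋯ + y_m)^n`. Only the six listed partitions dominate
any of the six, so the table closes up and is computed column by column.

The zonal polynomials are selected by `Classical.epsilon`, so a zonal family must also be shown to
exist. The same triangular system provides it (`exists_triangular_family`, `exists_isZonalFamily`).
The computation applies to any family with the defining properties, so uniqueness is not needed
separately. -/

noncomputable section

namespace Zonal

/-! ### Partitions, exponent vectors and sorting -/

/-- The multiset of the nonzero values among `u 0, …, u (m - 1)`. -/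
def shape (m : ℕ) (u : ℕ → ℕ) : Multiset ℕ := ((Multiset.range m).map u).filter (· ≠ 0)

theorem part_eq_zero {n : ℕ} (p : n.Partition) {i : ℕ} (h : p.parts.card ≤ i) : part p i = 0 := by
  unfold part
  rw [List.getD_eq_default]
  simpa using h

theorem part_antitone {n : ℕ} (p : n.Partition) : Antitone (part p) := by
  intro i j hij
  rcases lt_or_ge j p.parts.card with h | h
  · rcases hij.eq_or_lt with rfl | hij
    · rfl
    have hs := p.parts.pairwise_sort (fun a b => b ≤ a)
    rw [List.pairwise_iff_getElem] at hs
    have := hs i j (by simp; omega) (by simpa) hij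
    unfold part
    rwa [List.getD_eq_getElem, List.getD_eq_getElem]
  · rw [part_eq_zero p h]; exact Nat.zero_le _

theorem map_part {n : ℕ} (p : n.Partition) :
    (Multiset.range p.parts.card).map (part p) = p.parts := by
  conv_rhs => rw [← p.parts.sort_eq (fun a b => b ≤ a)]
  rw [← Multiset.coe_range, Multiset.map_coe, Multiset.coe_eq_coe]
  apply List.Perm.of_eq
  apply List.ext_getElem
  · simp
  · intro i h1 h2
    simp [part, List.getElem?_eq_getElem h2]

theorem shape_eq_of_le {c m : ℕ} {u : ℕ → ℕ} (h : c ≤ m) (hu : ∀ k, c ≤ k → u k = 0) :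
    shape m u = shape c u := by
  induction m, h using Nat.le_induction with
  | base => rfl
  | succ m hm ih => simp only [shape, Multiset.range_succ, Multiset.map_cons] at ih ⊢
                    rw [Multiset.filter_cons_of_neg _ (by simp [hu m hm]), ih]

theorem shape_part {n m : ℕ} (p : n.Partition) (h : p.parts.card ≤ m) :
    shape m (part p) = p.parts := by
  rw [shape_eq_of_le h fun k hk => part_eq_zero p hk, shape, map_part,
    Multiset.filter_eq_self]
  exact fun a ha => (p.parts_pos ha).ne'

theorem sum_shape (m : ℕ) (u : ℕ → ℕ) : (shape m u).sum = ∑ i ∈ Finset.range m, u i := by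
  have := Multiset.filter_add_not (· ≠ 0) ((Multiset.range m).map u)
  have h2 : ((Multiset.range m).map u).sum = ∑ i ∈ Finset.range m, u i := rfl
  rw [← h2, ← this, Multiset.sum_add, shape, left_eq_add]
  apply Multiset.sum_eq_zero
  simp

theorem card_shape_le (m : ℕ) (u : ℕ → ℕ) : (shape m u).card ≤ m := by
  refine (Multiset.card_le_card (Multiset.filter_le _ _)).trans ?_
  simp

theorem sum_part {n m : ℕ} (p : n.Partition) (h : p.parts.card ≤ m) :
    ∑ i ∈ Finset.range m, part p i = n := by
  rw [← sum_shape, shape_part p h, p.parts_sum]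

/-- Discarding the zeros loses nothing, since their number is `m` minus the number of nonzero
entries. -/
theorem map_eq_of_shape_eq {m : ℕ} {u v : ℕ → ℕ} (h : shape m u = shape m v) :
    (Multiset.range m).map u = (Multiset.range m).map v := by
  have key : ∀ w : ℕ → ℕ, (Multiset.range m).map w =
      shape m w + Multiset.replicate (m - (shape m w).card) 0 := by
    intro w
    have := Multiset.filter_add_not (· ≠ 0) ((Multiset.range m).map w)
    conv_lhs => rw [← this]
    congr 1
    rw [Multiset.eq_replicate]
    refine ⟨?_, by simp⟩
    have := congrArg Multiset.card this
    simp only [Multiset.card_add, Multiset.card_map, Multiset.card_range] at this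
    simp only [shape]
    omega
  rw [key u, key v, h]

theorem map_univ_val {m : ℕ} (w : ℕ → ℕ) :
    (Finset.univ : Finset (Fin m)).val.map (fun i : Fin m => w i) = (Multiset.range m).map w := by
  rw [← Finset.range_val, ← Nat.Iio_eq_range, ← Fin.map_valEmbedding_univ, Finset.map_val,
    Multiset.map_map]
  rfl

/-- The multiset of the nonzero values of an exponent vector. -/
def finShape {m : ℕ} (e : Fin m → ℕ) : Multiset ℕ := (Finset.univ.val.map e).filter (· ≠ 0)

theorem finShape_val {m : ℕ} (u : ℕ → ℕ) : finShape (fun i : Fin m => u i) = shape m u := by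
  rw [finShape, map_univ_val, shape]

theorem finShape_comp {m : ℕ} (e : Fin m → ℕ) (σ : Equiv.Perm (Fin m)) :
    finShape (e ∘ σ) = finShape e := by
  rw [finShape, ← Multiset.map_map, Multiset.map_univ_val_equiv, finShape]

theorem exists_antitone_comp {m : ℕ} (e : Fin m → ℕ) :
    ∃ σ : Equiv.Perm (Fin m), Antitone (e ∘ σ) :=
  ⟨Fin.revPerm.trans (Tuple.sort e), fun i j hij =>
    Tuple.monotone_sort e (by simpa using hij : Fin.rev j ≤ Fin.rev i)⟩

/-- Two weakly decreasing lists that are permutations of each other coincide. -/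
theorem part_eq_of_shape {n m : ℕ} {u : ℕ → ℕ} {p : n.Partition} (h : shape m u = p.parts)
    (hu : ∀ i j, i ≤ j → j < m → u j ≤ u i) {i : ℕ} (hi : i < m) : part p i = u i := by
  have h2 := map_eq_of_shape_eq (h.trans (shape_part p (h ▸ card_shape_le m u)).symm)
  have h3 : (List.range m).map u = (List.range m).map (part p) := by
    apply List.Perm.eq_of_sortedGE
    · rw [List.sortedGE_iff_pairwise, List.pairwise_iff_getElem]
      intro i j _ hj hij
      simp at hj ⊢
      exact hu _ _ hij.le hj
    · rw [List.sortedGE_iff_pairwise, List.pairwise_iff_getElem]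
      intro i j _ hj hij
      simp
      exact part_antitone p hij.le
    · rw [← Multiset.coe_eq_coe, ← Multiset.map_coe, ← Multiset.map_coe, Multiset.coe_range]
      exact h2
  have := congrArg (fun l => l[i]?) h3
  simpa [hi] using this.symm

theorem part_eq_of_finShape {n m : ℕ} {e : Fin m → ℕ} {p : n.Partition}
    (h : finShape e = p.parts) (he : Antitone e) (i : Fin m) : part p i = e i := by
  have h1 : e = fun i : Fin m => (fun k => if hk : k < m then e ⟨k, hk⟩ else 0) (i : ℕ) := by
    ext i; simp
  rw [h1, finShape_val (fun k => if hk : k < m then e ⟨k, hk⟩ else 0)] at h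
  rw [part_eq_of_shape h _ i.2]
  · simp
  · intro i j hij hj
    simpa [hj, hij.trans_lt hj] using he (by simpa using hij)

/-- Induction on the largest element `a` of the set: the other elements lie below `a`, so there are
at most `a` of them, and `f a` is at most the new last summand on the right. -/
theorem sum_le_sum_range_of_antitone {f : ℕ → ℕ} (hf : Antitone f) (S : Finset ℕ) :
    ∑ i ∈ S, f i ≤ ∑ i ∈ Finset.range S.card, f i := by
  induction S using Finset.induction_on_max with
  | empty => simp
  | insert a S ha ih =>
    have : a ∉ S := fun h => (ha a h).false
    rw [Finset.sum_insert this, Finset.card_insert_of_notMem this, Finset.sum_range_succ, add_comm]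
    have : S.card ≤ a := by
      have : S ⊆ Finset.range a := fun x hx => Finset.mem_range.2 (ha x hx)
      simpa using Finset.card_le_card this
    exact add_le_add ih (hf this)

/-- The first `k` entries occupy `k` distinct positions of the sorted arrangement, and no `k`
positions there carry more than the first `k`. -/
theorem sum_le_sum_part {n m k : ℕ} {u : ℕ → ℕ} {p : n.Partition} (h : shape m u = p.parts)
    (hk : k ≤ m) : ∑ i ∈ Finset.range k, u i ≤ ∑ i ∈ Finset.range k, part p i := by
  obtain ⟨σ, hσ⟩ := exists_antitone_comp (fun i : Fin m => u i)
  have hp := part_eq_of_finShape (p := p) (by rw [finShape_comp, finShape_val, h]) hσ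
  have h1 : ∑ i ∈ Finset.range k, u i = ∑ i : Fin k, u (Fin.castLE hk i) := by
    rw [Finset.sum_range]; rfl
  have h2 := sum_le_sum_range_of_antitone (part_antitone p)
    ((Finset.univ : Finset (Fin k)).map ⟨fun i => (σ.symm (Fin.castLE hk i) : ℕ), fun i j hij => by
      simpa [Fin.val_inj] using hij⟩)
  simp only [Finset.sum_map, Finset.card_map, Finset.card_univ, Fintype.card_fin] at h2
  rw [h1]
  refine le_trans (le_of_eq ?_) h2
  refine Finset.sum_congr rfl fun i _ => ?_
  have := hp (σ.symm (Fin.castLE hk i))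
  simp only [Function.comp_apply, Equiv.apply_symm_apply] at this
  exact this.symm

/-! ### Strict monotonicity of `ρ` along the dominance order -/

/-- Summation by parts. The weights may be negative because the total of `d` is zero, which kills
the boundary term. -/
theorem sum_mul_nonneg_of_antitone {w d : ℕ → ℝ} (hw : Antitone w)
    (hd : ∀ k, 0 ≤ ∑ i ∈ Finset.range k, d i) {N : ℕ} (hN : ∑ i ∈ Finset.range N, d i = 0) :
    0 ≤ ∑ i ∈ Finset.range N, d i * w i := by
  have key : ∀ k, (∑ i ∈ Finset.range (k + 1), d i) * w k ≤
      ∑ i ∈ Finset.range (k + 1), d i * w i := by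
    intro k
    induction k with
    | zero => simp
    | succ k ih =>
      rw [Finset.sum_range_succ, Finset.sum_range_succ (fun i => d i * w i), add_mul]
      have := mul_le_mul_of_nonneg_left (hw (Nat.le_succ k)) (hd (k + 1))
      simp only [Nat.succ_eq_add_one] at this
      linarith
  cases N with
  | zero => simp
  | succ k =>
    have := key k
    rwa [hN, zero_mul] at this

theorem rho_eq_sum {n N : ℕ} (p : n.Partition) (h : p.parts.card ≤ N) :
    rho p = ∑ i ∈ Finset.range N, (part p i : ℝ) * ((part p i : ℝ) - ((i : ℝ) + 1)) := by
  refine Finset.sum_subset (by simpa using h) fun i _ hi => ?_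
  rw [part_eq_zero p (by simpa using hi)]
  simp

theorem ext_part {n : ℕ} {p q : n.Partition} (h : ∀ i, part p i = part q i) : p = q := by
  have h1 := shape_part p (le_max_left p.parts.card q.parts.card)
  have h2 := shape_part q (le_max_right p.parts.card q.parts.card)
  rw [funext h] at h1
  exact Nat.Partition.ext (h1.symm.trans h2)

theorem Dominates.refl {n : ℕ} (p : n.Partition) : Dominates p p := fun _ => le_rfl

theorem Dominates.trans {n : ℕ} {p q r : n.Partition} (h : Dominates p q) (h' : Dominates q r) :
    Dominates p r := fun k => (h' k).trans (h k)

/-- With `d = κ - λ`, one has `ρ_κ - ρ_λ = ∑ dᵢ² + ∑ dᵢ (2λᵢ - i)`. The first sum is positive. The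
second is nonnegative by summation by parts, since `2λᵢ - i` decreases and dominance says that the
partial sums of `d` are nonnegative. -/
theorem Dominates.rho_lt {n : ℕ} {κ l : n.Partition} (h : Dominates κ l) (hne : κ ≠ l) :
    rho l < rho κ := by
  set N := max κ.parts.card l.parts.card
  have hκ : κ.parts.card ≤ N := le_max_left _ _
  have hl : l.parts.card ≤ N := le_max_right _ _
  have h1 : 0 ≤ ∑ i ∈ Finset.range N, ((part κ i : ℝ) - part l i) * (2 * part l i - (i + 1)) := by
    apply sum_mul_nonneg_of_antitone
    · intro i j hij
      have h2 : (part l j : ℝ) ≤ part l i := by exact_mod_cast part_antitone l hij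
      have h3 : (i : ℝ) ≤ j := by exact_mod_cast hij
      simp only
      linarith
    · intro k
      rw [Finset.sum_sub_distrib, sub_nonneg]
      exact_mod_cast h k
    · rw [Finset.sum_sub_distrib, sub_eq_zero]
      have := (sum_part κ hκ).trans (sum_part l hl).symm
      exact_mod_cast this
  have h2 : 0 < ∑ i ∈ Finset.range N, ((part κ i : ℝ) - part l i) ^ 2 := by
    obtain ⟨i, hi⟩ : ∃ i, part κ i ≠ part l i := by
      by_contra! hc
      exact hne (ext_part hc)
    refine Finset.sum_pos' (fun _ _ => sq_nonneg _) ⟨i, ?_, ?_⟩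
    · rw [Finset.mem_range]
      by_contra! hc
      exact hi (by rw [part_eq_zero κ (hκ.trans hc), part_eq_zero l (hl.trans hc)])
    · have : (part κ i : ℝ) - part l i ≠ 0 := by
        rw [sub_ne_zero]; exact_mod_cast hi
      positivity
  have h3 : rho κ - rho l =
      ∑ i ∈ Finset.range N, ((part κ i : ℝ) - part l i) ^ 2 +
      ∑ i ∈ Finset.range N, ((part κ i : ℝ) - part l i) * (2 * part l i - (i + 1)) := by
    rw [rho_eq_sum κ hκ, rho_eq_sum l hl, ← Finset.sum_sub_distrib, ← Finset.sum_add_distrib]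
    exact Finset.sum_congr rfl fun i _ => by ring
  linarith

/-! ### Moving units between entries -/

/-- Move `t` units from the `j`-th to the `i`-th entry of `u`. -/
def move (u : ℕ → ℕ) (i j t : ℕ) (k : ℕ) : ℕ :=
  if k = i then u i + t else if k = j then u j - t else u k

/-- Exactly the partial sums with `i < k ≤ j` grow, by `t`. The two corrections are added on
opposite sides to avoid truncated subtraction. -/
theorem sum_move {u : ℕ → ℕ} {i j t : ℕ} (hij : i < j) (ht : t ≤ u j) (k : ℕ) :
    ∑ x ∈ Finset.range k, move u i j t x + (if j < k then t else 0) =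
      ∑ x ∈ Finset.range k, u x + (if i < k then t else 0) := by
  induction k with
  | zero => simp
  | succ k ih =>
    rw [Finset.sum_range_succ, Finset.sum_range_succ]
    have : move u i j t k + (if j = k then t else 0) = u k + (if i = k then t else 0) := by
      unfold move
      by_cases h1 : k = i
      · subst h1; simp [hij.ne']
      · by_cases h2 : k = j
        · subst h2; simp [hij.ne, h1]; omega
        · simp [h1, h2, Ne.symm h1, Ne.symm h2]
    split_ifs at * <;> omega

/-- Moving units to the left does not lower any partial sum, and sorting can only raise them
further. The sum of the first `i + 1` entries grows strictly, which rules out equality. -/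
theorem dominates_of_shape_move {n m : ℕ} {p q : n.Partition} (hp : p.parts.card ≤ m)
    {i j t : ℕ} (hij : i < j) (hj : j < m) (ht : t ≤ part p j) (ht0 : 0 < t)
    (hq : shape m (move (part p) i j t) = q.parts) : Dominates q p ∧ q ≠ p := by
  have hqm : q.parts.card ≤ m := hq ▸ card_shape_le _ _
  refine ⟨fun k => ?_, ?_⟩
  · rcases le_total k m with hk | hk
    · refine le_trans ?_ (sum_le_sum_part hq hk)
      have := sum_move hij ht k
      split_ifs at this <;> omega
    · rw [sum_part p (hp.trans hk), sum_part q (hqm.trans hk)]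
  · rintro rfl
    have h1 := sum_le_sum_part hq (k := i + 1) (by omega)
    have := sum_move hij ht (i + 1)
    split_ifs at this <;> omega

/-! ### Solving a triangular eigenvalue problem -/

/-- The matrix `A` feeds column `l` only from columns with larger `d`, so the columns can be built
by well-founded recursion. Off the diagonal the eigenvalue equation is solved by division; the
diagonal entry is free and is spent on the prescribed column sum `v l`. -/
theorem exists_triangular_family {P : Type*} [Fintype P] [DecidableEq P] (R : P → P → Prop)
    (refl : ∀ a, R a a) (trans : ∀ a b c, R a b → R b c → R a c) (d : P → ℝ)
    (hd : ∀ a b, R a b → a ≠ b → d b < d a) (A : P → P → ℝ)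
    (hA : ∀ l μ, A l μ ≠ 0 → R μ l ∧ μ ≠ l) (v : P → ℝ) :
    ∃ c : P → P → ℝ, (∀ κ l, c κ l ≠ 0 → R κ l) ∧
      (∀ κ l, (d κ - d l) * c κ l = ∑ μ, A l μ * c κ μ) ∧ ∀ l, ∑ κ, c κ l = v l := by
  classical
  let r : P → P → Prop := fun μ l => d l < d μ
  have : IsTrans P r := ⟨fun a b c h1 h2 => lt_trans h2 h1⟩
  have : Std.Irrefl r := ⟨fun a h => lt_irrefl _ h⟩
  have wf : WellFounded r := Finite.wellFounded_of_trans_of_irrefl r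
  let b : (l : P) → ((μ : P) → r μ l → P → ℝ) → P → ℝ := fun l ih κ =>
    (d κ - d l)⁻¹ * ∑ μ, if h : r μ l then A l μ * ih μ h κ else 0
  let F : (l : P) → ((μ : P) → r μ l → P → ℝ) → P → ℝ := fun l ih κ =>
    if κ = l then v l - ∑ κ' ∈ Finset.univ.erase l, b l ih κ' else b l ih κ
  let c : P → P → ℝ := fun κ l => wf.fix F l κ
  -- The guard `r μ l` in the recursion can be dropped, because `A l μ` vanishes where it fails.
  have hb : ∀ κ l, b l (fun μ _ => wf.fix F μ) κ = (d κ - d l)⁻¹ * ∑ μ, A l μ * c κ μ := by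
    intro κ l
    simp only [b]
    congr 1
    refine Finset.sum_congr rfl fun μ _ => ?_
    split_ifs with h
    · rfl
    · have : A l μ = 0 := by
        by_contra h0
        exact h (hd _ _ (hA _ _ h0).1 (hA _ _ h0).2)
      rw [this, zero_mul]
  have hne : ∀ κ l, κ ≠ l → c κ l = (d κ - d l)⁻¹ * ∑ μ, A l μ * c κ μ := by
    intro κ l h
    rw [← hb]
    change wf.fix F l κ = _
    rw [wf.fix_eq]
    simp only [F, if_neg h]
  have heq : ∀ l, c l l = v l - ∑ κ ∈ Finset.univ.erase l, c κ l := by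
    intro l
    change wf.fix F l l = _
    rw [wf.fix_eq]
    simp only [F, if_true]
    congr 1
    refine Finset.sum_congr rfl fun κ hκ => ?_
    rw [hb, hne κ l (Finset.ne_of_mem_erase hκ)]
  have hR : ∀ l κ, c κ l ≠ 0 → R κ l := by
    intro l
    induction l using wf.induction with
    | _ l ih =>
      intro κ h
      by_cases hκ : κ = l
      · subst hκ; exact refl _
      rw [hne κ l hκ] at h
      obtain ⟨μ, -, hμ⟩ := Finset.exists_ne_zero_of_sum_ne_zero (right_ne_zero_of_mul h)
      have h1 := hA _ _ (left_ne_zero_of_mul hμ)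
      exact trans _ _ _ (ih μ (hd _ _ h1.1 h1.2) κ (right_ne_zero_of_mul hμ)) h1.1
  refine ⟨c, fun κ l => hR l κ, fun κ l => ?_, fun l => ?_⟩
  -- When the eigenvalues agree, in particular for `κ = l`, there is nothing to divide by. The right
  -- side must then vanish: a nonzero term would force `d l < d μ ≤ d κ`.
  · by_cases hκ : d κ = d l
    · rw [hκ, sub_self, zero_mul, eq_comm]
      refine Finset.sum_eq_zero fun μ _ => ?_
      by_contra h
      have h1 := hA _ _ (left_ne_zero_of_mul h)
      have h2 := hR _ _ (right_ne_zero_of_mul h)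
      have h3 := hd _ _ h1.1 h1.2
      by_cases h4 : κ = μ
      · subst h4; exact h3.ne hκ.symm
      · exact ((hd _ _ h2 h4).trans' h3).ne hκ.symm
    · rw [hne κ l (fun h => hκ (by rw [h])), mul_inv_cancel_left₀ (sub_ne_zero.2 hκ)]
  · rw [← Finset.add_sum_erase _ _ (Finset.mem_univ l), heq, sub_add_cancel]

/-! ### Divided differences of symmetric polynomials -/

/-- The product of `F` with all `X i - X j`, `i ≠ j`, vanishes at every point, hence is zero, and
the polynomial ring is a domain. This transfers identities from points with distinct coordinates,
where the operator makes sense, to polynomials. -/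
theorem eq_zero_of_eval_injective {m : ℕ} {F : MvPolynomial (Fin m) ℝ}
    (h : ∀ y : Fin m → ℝ, Function.Injective y → eval y F = 0) : F = 0 := by
  have h1 : F * ∏ i : Fin m, ∏ j ∈ Finset.univ.erase i, (X i - X j) = 0 := by
    apply MvPolynomial.funext
    intro y
    rw [map_zero, map_mul]
    by_cases hy : Function.Injective y
    · rw [h y hy, zero_mul]
    · simp only [Function.Injective, not_forall] at hy
      obtain ⟨i, j, hij, hne⟩ := hy
      simp only [map_prod, map_sub, eval_X]
      rw [Finset.prod_eq_zero (Finset.mem_univ i), mul_zero]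
      rw [Finset.prod_eq_zero (i := j) (by simp [Ne.symm hne])]
      simp [hij]
  refine (mul_eq_zero.1 h1).resolve_right ?_
  refine Finset.prod_ne_zero_iff.2 fun i _ => Finset.prod_ne_zero_iff.2 fun j hj => ?_
  rw [sub_ne_zero]
  exact fun hc => (Finset.ne_of_mem_erase hj) (X_injective hc).symm

/-- Modulo `X i - X j`, the polynomial `F` agrees with its image under the substitution `X i ↦ X j`.
That substitution does not see the swap, so the image equals its own negative and is zero. -/
theorem X_sub_X_dvd_of_rename_swap {σ : Type*} [DecidableEq σ] {F : MvPolynomial σ ℝ} {i j : σ}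
    (h : rename (Equiv.swap i j) F = -F) : (X i - X j) ∣ F := by
  let φ : MvPolynomial σ ℝ →ₐ[ℝ] MvPolynomial σ ℝ := aeval fun k => if k = i then X j else X k
  have h1 : (X i - X j) ∣ F - φ F := by
    rw [← Ideal.mem_span_singleton, ← Ideal.Quotient.eq]
    let q := Ideal.Quotient.mkₐ ℝ (Ideal.span {(X i - X j : MvPolynomial σ ℝ)})
    have : q = q.comp φ := by
      ext k
      simp only [AlgHom.comp_apply, φ, aeval_X]
      split_ifs with hk
      · subst hk
        exact Ideal.Quotient.eq.2 (Ideal.mem_span_singleton_self _)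
      · rfl
    exact DFunLike.congr_fun this F
  have h2 : φ F = φ (rename (Equiv.swap i j) F) := by
    simp only [φ, aeval_rename]
    congr 2
    ext1 k
    simp only [Function.comp_apply]
    by_cases hki : k = i
    · subst hki
      rw [Equiv.swap_apply_left, if_pos rfl, ite_self]
    · by_cases hkj : k = j
      · subst hkj
        rw [Equiv.swap_apply_right, if_pos rfl, if_neg hki]
      · rw [Equiv.swap_apply_of_ne_of_ne hki hkj]
  rw [h, map_neg] at h2
  have h3 : φ F = 0 := self_eq_neg.1 h2
  rwa [h3, sub_zero] at h1

/-- The right side is the numerator of the combined `(i, j)` terms of the operator; swapping `i` and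
`j` negates it when `f` is symmetric. -/
theorem exists_dividedDifference {m : ℕ} {f : MvPolynomial (Fin m) ℝ} (hf : f.IsSymmetric)
    (i j : Fin m) : ∃ g : MvPolynomial (Fin m) ℝ,
      (X i - X j) * g = X i * (X i * pderiv i f) - X j * (X j * pderiv j f) := by
  have : (X i - X j) ∣ X i * (X i * pderiv i f) - X j * (X j * pderiv j f) := by
    apply X_sub_X_dvd_of_rename_swap
    have key : ∀ k, rename (Equiv.swap i j) (pderiv k f) = pderiv (Equiv.swap i j k) f := by
      intro k
      rw [← pderiv_rename (Equiv.injective _), hf]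
    simp [key]
  obtain ⟨g, hg⟩ := this
  exact ⟨g, hg.symm⟩

theorem coeff_X_mul_pderiv {σ : Type*} (f : MvPolynomial σ ℝ) (i : σ) (e : σ →₀ ℕ) :
    coeff e (X i * pderiv i f) = e i * coeff e f := by
  classical
  rw [coeff_X_mul']
  split_ifs with h
  · have h1 : 1 ≤ e i := Nat.one_le_iff_ne_zero.2 (Finsupp.mem_support_iff.1 h)
    rw [coeff_pderiv, tsub_add_cancel_of_le (Finsupp.single_le_iff.2 h1)]
    simp [Nat.cast_sub h1]; ring
  · simp [Finsupp.notMem_support_iff.1 h]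

/-- Write `εᵢ` for unit vectors. The coefficient of `e + εᵢ` in `hg` gives `g(e) - g(e + εᵢ - εⱼ) =
eᵢ f(e) - (eⱼ - 1) f(e + εᵢ - εⱼ)`. Iterating until exponent `j` is used up, the term `f(e + tεᵢ -
tεⱼ)` collects `(eᵢ + t) - (eⱼ - t)`. -/
theorem coeff_dividedDifference {σ : Type*} {f g : MvPolynomial σ ℝ} {i j : σ} (hij : i ≠ j)
    (hg : (X i - X j) * g = X i * (X i * pderiv i f) - X j * (X j * pderiv j f)) :
    ∀ (q : ℕ) (e : σ →₀ ℕ), e j = q → coeff e g = e i * coeff e f +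
      ∑ t ∈ Finset.range q, ((e i : ℝ) - q + 2 * (t + 1)) *
        coeff (e + Finsupp.single i (t + 1) - Finsupp.single j (t + 1)) f := by
  classical
  have hX : ∀ (p : MvPolynomial σ ℝ) (e : σ →₀ ℕ),
      coeff (e + Finsupp.single i 1) (X i * p) = coeff e p := by
    intro p e
    rw [add_comm, coeff_X_mul]
  -- If `e j = 0`, the shifted exponent does not exist: truncated subtraction would produce `e +
  -- εᵢ`, whereas the coefficient meant is zero.
  have hrec : ∀ e : σ →₀ ℕ, coeff e g - (if e j = 0 then 0 else
      coeff (e + Finsupp.single i 1 - Finsupp.single j 1) g) =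
      e i * coeff e f - (if e j = 0 then 0 else ((e j : ℝ) - 1) *
        coeff (e + Finsupp.single i 1 - Finsupp.single j 1) f) := by
    intro e
    have h := congrArg (coeff (e + Finsupp.single i 1)) hg
    rw [sub_mul, coeff_sub, coeff_sub, hX, hX, coeff_X_mul' _ j, coeff_X_mul' _ j,
      coeff_X_mul_pderiv, coeff_X_mul_pderiv] at h
    by_cases hj : e j = 0
    · simpa [hj, hij, hij.symm] using h
    · have : ((e j - 1 : ℕ) : ℝ) = e j - 1 := by
        rw [Nat.cast_sub (Nat.one_le_iff_ne_zero.2 hj), Nat.cast_one]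
      simpa [hj, hij, hij.symm, this] using h
  intro q
  induction q with
  | zero =>
    intro e he
    simpa [he] using hrec e
  | succ q ih =>
    intro e he
    have h := hrec e
    have he1 : (e + Finsupp.single i 1 - Finsupp.single j 1 : σ →₀ ℕ) j = q := by simp [he, hij]
    have he2 : (e + Finsupp.single i 1 - Finsupp.single j 1 : σ →₀ ℕ) i = e i + 1 := by
      simp [hij.symm]
    rw [if_neg (by omega), if_neg (by omega), ih _ he1, he2, he] at h
    rw [Finset.sum_range_succ']
    have h2 : ∀ t : ℕ, e + Finsupp.single i 1 - Finsupp.single j 1 + Finsupp.single i (t + 1) -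
        Finsupp.single j (t + 1) =
        e + Finsupp.single i (t + 1 + 1) - Finsupp.single j (t + 1 + 1) := by
      intro t
      ext k
      by_cases h1 : k = i
      · subst h1; simp [hij.symm]; ring
      · by_cases h2 : k = j
        · subst h2; simp [hij]; omega
        · simp [Ne.symm h1, Ne.symm h2]
    simp only [h2] at h
    push_cast at h ⊢
    have h3 : ∀ t : ℕ, (e i : ℝ) + 1 - q + 2 * (t + 1) = e i - (q + 1) + 2 * (t + 1 + 1) := by
      intro t; ring
    simp only [h3] at h
    simp only [zero_add]
    linear_combination h

/-! ### The Laplace-Beltrami operator on coefficients -/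

/-- The exponent vector `(u 0, …, u (m - 1))`. -/
def expo (m : ℕ) (u : ℕ → ℕ) : Fin m →₀ ℕ := Finsupp.equivFunOnFinite.symm fun i => u i

@[simp] theorem expo_apply (m : ℕ) (u : ℕ → ℕ) (i : Fin m) : expo m u i = u i := rfl

theorem expo_move (m : ℕ) (u : ℕ → ℕ) {i j : Fin m} (hij : i ≠ j) (t : ℕ) :
    expo m u + Finsupp.single i t - Finsupp.single j t = expo m (move u i j t) := by
  ext k
  by_cases h1 : k = i
  · subst h1; simp [hij.symm, move]
  · by_cases h2 : k = j
    · subst h2; simp [move, h1, Fin.val_inj]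
    · simp [move, h1, h2, Fin.val_inj]

theorem sum_Iio_eq_sum_range {m : ℕ} (F : ℕ → ℝ) (j : Fin m) :
    ∑ i ∈ Finset.Iio j, F i = ∑ i ∈ Finset.range j, F i := by
  rw [← Nat.Iio_eq_range, ← Fin.map_valEmbedding_Iio, Finset.sum_map]
  rfl

theorem laplaceBeltrami_comp {m : ℕ} {f : MvPolynomial (Fin m) ℝ} (hf : f.IsSymmetric)
    (y : Fin m → ℝ) (σ : Equiv.Perm (Fin m)) :
    laplaceBeltrami f (y ∘ σ) = laplaceBeltrami f y := by
  have key : ∀ k, rename σ (pderiv k f) = pderiv (σ k) f := by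
    intro k
    rw [← pderiv_rename σ.injective, hf]
  have key2 : ∀ k, rename σ (pderiv k (pderiv k f)) = pderiv (σ k) (pderiv (σ k) f) := by
    intro k
    rw [← pderiv_rename σ.injective, key]
  unfold laplaceBeltrami
  simp only [← eval_rename, key, key2]
  refine Fintype.sum_equiv σ _ _ fun i => ?_
  congr 1
  refine Finset.sum_equiv σ (by simp) fun j _ => rfl

/-- The second-order part acts diagonally on monomials, and each pair `i < j` contributes its
divided difference. Symmetry of `D` is recorded so that comparing sorted exponents will suffice
later. -/
theorem exists_laplaceBeltrami {m : ℕ} {f : MvPolynomial (Fin m) ℝ} (hf : f.IsSymmetric) :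
    ∃ D : MvPolynomial (Fin m) ℝ, D.IsSymmetric ∧
      (∀ y : Fin m → ℝ, Function.Injective y → eval y D = laplaceBeltrami f y) ∧
      ∀ u : ℕ → ℕ, coeff (expo m u) D =
        (∑ j ∈ Finset.range m, (u j : ℝ) * (u j - 1)) * coeff (expo m u) f +
        ∑ j ∈ Finset.range m, ∑ i ∈ Finset.range j, (u i * coeff (expo m u) f +
          ∑ t ∈ Finset.range (u j), ((u i : ℝ) - u j + 2 * (t + 1)) *
            coeff (expo m (move u i j (t + 1))) f) := by
  choose g hg using fun i j => exists_dividedDifference hf i j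
  let D : MvPolynomial (Fin m) ℝ := ∑ i, (X i * (X i * pderiv i (pderiv i f))) +
    ∑ j, ∑ i ∈ Finset.Iio j, g i j
  have heval : ∀ y : Fin m → ℝ, Function.Injective y → eval y D = laplaceBeltrami f y := by
    intro y hy
    have h1 : ∀ i : Fin m, ∑ j ∈ Finset.univ.erase i, y i ^ 2 / (y i - y j) *
        eval y (pderiv i f) =
        ∑ j ∈ Finset.Ioi i, y i ^ 2 / (y i - y j) * eval y (pderiv i f) +
        ∑ j ∈ Finset.Iio i, y i ^ 2 / (y i - y j) * eval y (pderiv i f) := by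
      intro i
      rw [← Finset.sum_union]
      · congr 1
        ext j
        simp [lt_or_lt_iff_ne, eq_comm]
      · exact Finset.disjoint_left.2 fun j h1 h2 => by
          simp at h1 h2; exact (h1.trans h2).false
    unfold laplaceBeltrami
    simp only [D, map_add, map_sum, map_mul, eval_X, Finset.sum_add_distrib, h1]
    congr 1
    · exact Finset.sum_congr rfl fun i _ => by ring
    -- Exchanging the order of summation in the terms with `i < j` brings both halves of each pair
    -- together.
    · rw [Finset.sum_comm' (s := Finset.univ) (t := fun i => Finset.Ioi i) (t' := Finset.univ)
        (s' := fun j => Finset.Iio j) (by simp), ← Finset.sum_add_distrib]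
      refine Finset.sum_congr rfl fun j _ => ?_
      rw [← Finset.sum_add_distrib]
      refine Finset.sum_congr rfl fun i hi => ?_
      have hij : i ≠ j := (Finset.mem_Iio.1 hi).ne
      have h2 := congrArg (eval y) (hg i j)
      simp only [map_sub, map_mul, eval_X] at h2
      have h3 : y i - y j ≠ 0 := sub_ne_zero.2 (hy.ne hij)
      have h4 : y j - y i ≠ 0 := sub_ne_zero.2 (hy.ne hij.symm)
      have h5 : y j - y i = -(y i - y j) := by ring
      rw [h5]
      field_simp
      linear_combination h2
  refine ⟨D, fun σ => ?_, heval, fun u => ?_⟩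
  · rw [← sub_eq_zero]
    refine eq_zero_of_eval_injective fun y hy => ?_
    rw [map_sub, eval_rename, heval _ hy, heval _ (hy.comp σ.injective), laplaceBeltrami_comp hf,
      sub_self]
  · simp only [D, coeff_add, coeff_sum]
    congr 1
    · rw [Finset.sum_range, Finset.sum_mul]
      refine Finset.sum_congr rfl fun i _ => ?_
      -- `y² ∂² = (y ∂)² - y ∂`, and `y ∂` multiplies a monomial by its exponent, whence `u (u -
      -- 1)`.
      have h1 : (X i * (X i * pderiv i (pderiv i f)) : MvPolynomial (Fin m) ℝ) =
          X i * pderiv i (X i * pderiv i f) - X i * pderiv i f := by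
        rw [pderiv_mul, pderiv_X_self]; ring
      rw [h1, coeff_sub, coeff_X_mul_pderiv, coeff_X_mul_pderiv, expo_apply]
      ring
    · rw [Finset.sum_range]
      refine Finset.sum_congr rfl fun j _ => ?_
      rw [← sum_Iio_eq_sum_range]
      refine Finset.sum_congr rfl fun i hi => ?_
      have hij : i ≠ j := (Finset.mem_Iio.1 hi).ne
      rw [coeff_dividedDifference hij (hg i j) (u j) (expo m u) rfl]
      simp only [expo_move m u hij, expo_apply]

/-! ### Coefficients in the monomial symmetric polynomials -/

theorem ofSym_parts_eq_finShape {m n : ℕ} (s : Sym (Fin m) n) :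
    (Nat.Partition.ofSym s).parts = finShape (Multiset.toFinsupp (s : Multiset (Fin m))) := by
  change (s : Multiset (Fin m)).dedup.map (fun a => (s : Multiset (Fin m)).count a) = _
  rw [finShape, Multiset.filter_map]
  congr 1
  · rw [Multiset.Nodup.ext (Multiset.nodup_dedup _) (Finset.univ.nodup.filter _)]
    intro a
    simp

theorem map_X_prod_eq_monomial {σ : Type*} [DecidableEq σ] (s : Multiset σ) :
    (s.map X).prod = (monomial (Multiset.toFinsupp s) 1 : MvPolynomial σ ℝ) := by
  induction s using Multiset.induction with
  | empty => simp
  | cons a s ih =>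
    rw [Multiset.map_cons, Multiset.prod_cons, ih, ← Multiset.singleton_add, map_add,
      Multiset.toFinsupp_singleton, X, monomial_mul, one_mul]

/-- The summands of `msymm` are distinct monomials, indexed by multisets; the only one that can
produce `e` is `Finsupp.toMultiset e`. -/
theorem coeff_msymm {m n : ℕ} (μ : n.Partition) (e : Fin m →₀ ℕ) :
    coeff e (msymm (Fin m) ℝ μ) = if finShape e = μ.parts then 1 else 0 := by
  rw [msymm, coeff_sum]
  have h1 : ∀ s : {a : Sym (Fin m) n // Nat.Partition.ofSym a = μ},
      coeff e (((s : Sym (Fin m) n) : Multiset (Fin m)).map X).prod =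
      if Multiset.toFinsupp ((s : Sym (Fin m) n) : Multiset (Fin m)) = e then (1 : ℝ) else 0 := by
    intro s
    rw [map_X_prod_eq_monomial, coeff_monomial]
  refine (Finset.sum_congr rfl fun s _ => h1 s).trans ?_
  split_ifs with h
  · have hcard : (Finsupp.toMultiset e).card = n := by
      rw [Finsupp.card_toMultiset, Finsupp.sum_fintype _ _ (fun _ => rfl), ← μ.parts_sum, ← h]
      have h2 := Multiset.filter_add_not (· ≠ 0) (Finset.univ.val.map e)
      change (Finset.univ.val.map e).sum = (Multiset.filter (· ≠ 0) (Finset.univ.val.map e)).sum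
      conv_lhs => rw [← h2]
      rw [Multiset.sum_add, add_eq_left]
      exact Multiset.sum_eq_zero (by simp)
    let s₀ : Sym (Fin m) n := ⟨Finsupp.toMultiset e, hcard⟩
    have hs₀ : Multiset.toFinsupp (s₀ : Multiset (Fin m)) = e := Finsupp.toMultiset_toFinsupp e
    have hμ : Nat.Partition.ofSym s₀ = μ :=
      Nat.Partition.ext (by rw [ofSym_parts_eq_finShape, hs₀, h])
    rw [Finset.sum_eq_single ⟨s₀, hμ⟩]
    · rw [if_pos hs₀]
    · intro s _ hs
      rw [if_neg]
      intro hse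
      exact hs (Subtype.ext (Sym.coe_injective (Multiset.toFinsupp.injective (hse.trans hs₀.symm))))
    · simp
  · refine Finset.sum_eq_zero fun s _ => if_neg ?_
    rintro rfl
    exact h (by rw [← ofSym_parts_eq_finShape, s.2])

/-- A function on the partitions of `n`, as a function of their multisets of parts. -/
def onParts {n : ℕ} (c : n.Partition → ℝ) (s : Multiset ℕ) : ℝ :=
  ∑ l, if s = l.parts then c l else 0

theorem onParts_parts {n : ℕ} (c : n.Partition → ℝ) (l : n.Partition) :
    onParts c l.parts = c l := by
  rw [onParts, Finset.sum_eq_single l]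
  · simp
  · intro μ _ h
    exact if_neg fun hc => h (Nat.Partition.ext hc.symm)
  · simp

theorem onParts_eq_zero {n : ℕ} (c : n.Partition → ℝ) {s : Multiset ℕ} (h : s.sum ≠ n) :
    onParts c s = 0 := by
  refine Finset.sum_eq_zero fun l _ => if_neg ?_
  rintro rfl
  exact h l.parts_sum

theorem coeff_sum_smul_msymm {m n : ℕ} (c : n.Partition → ℝ) (e : Fin m →₀ ℕ) :
    coeff e (∑ l, c l • msymm (Fin m) ℝ l) = onParts c (finShape e) := by
  simp [coeff_sum, coeff_msymm, onParts]

theorem coeff_expo_sum_smul_msymm {m n : ℕ} (c : n.Partition → ℝ) (u : ℕ → ℕ) :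
    coeff (expo m u) (∑ l, c l • msymm (Fin m) ℝ l) = onParts c (shape m u) := by
  rw [coeff_sum_smul_msymm, ← finShape_val]
  rfl

theorem isSymmetric_sum_smul_msymm {m n : ℕ} (c : n.Partition → ℝ) :
    (∑ l, c l • msymm (Fin m) ℝ l).IsSymmetric :=
  (symmetricSubalgebra (Fin m) ℝ).sum_mem fun l _ => (msymm_isSymmetric _ _ l).smul _

theorem coeff_comp_of_isSymmetric {m : ℕ} {f : MvPolynomial (Fin m) ℝ} (hf : f.IsSymmetric)
    (e : Fin m →₀ ℕ) (σ : Equiv.Perm (Fin m)) :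
    coeff (Finsupp.equivFunOnFinite.symm (e ∘ σ)) f = coeff e f := by
  conv_lhs => rw [← hf σ.symm]
  rw [← coeff_rename_mapDomain σ.symm σ.symm.injective f e]
  congr 1
  ext i
  have := Finsupp.mapDomain_apply σ.symm.injective e (σ i)
  simp only [Equiv.symm_apply_apply] at this
  simp [this]

theorem exists_expo {m : ℕ} (e : Fin m → ℕ) :
    ∃ u : ℕ → ℕ, (∀ k, m ≤ k → u k = 0) ∧ (Antitone e → Antitone u) ∧
      Finsupp.equivFunOnFinite.symm e = expo m u := by
  refine ⟨fun k => if hk : k < m then e ⟨k, hk⟩ else 0, fun k hk => by simp [hk],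
    fun he i j hij => ?_, ?_⟩
  · by_cases hj : j < m
    · simpa [hj, hij.trans_lt hj] using he (by simpa using hij)
    · simp [hj]
  · ext i; simp

/-- Every exponent vector can be sorted by a permutation of the variables, which a symmetric
polynomial does not notice. -/
theorem ext_of_isSymmetric {m : ℕ} {f g : MvPolynomial (Fin m) ℝ} (hf : f.IsSymmetric)
    (hg : g.IsSymmetric)
    (h : ∀ u : ℕ → ℕ, Antitone u → (∀ k, m ≤ k → u k = 0) →
      coeff (expo m u) f = coeff (expo m u) g) : f = g := by
  ext e
  obtain ⟨σ, hσ⟩ := exists_antitone_comp e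
  obtain ⟨u, hu0, hu, he⟩ := exists_expo (e ∘ σ)
  rw [← coeff_comp_of_isSymmetric hf e σ, ← coeff_comp_of_isSymmetric hg e σ, he]
  exact h u (hu hσ) hu0

theorem exists_partition_of_antitone {m n : ℕ} {u : ℕ → ℕ} (hu : Antitone u)
    (hu0 : ∀ k, m ≤ k → u k = 0) (hn : ∑ i ∈ Finset.range m, u i = n) :
    ∃ l : n.Partition, l.parts.card ≤ m ∧ part l = u := by
  let l : n.Partition := ⟨shape m u, fun {i} hi => Nat.pos_of_ne_zero (Multiset.mem_filter.1 hi).2,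
    by rw [sum_shape, hn]⟩
  have hl : l.parts.card ≤ m := card_shape_le m u
  refine ⟨l, hl, funext fun i => ?_⟩
  rcases lt_or_ge i m with hi | hi
  · exact part_eq_of_shape (p := l) rfl (fun i j hij _ => hu hij) hi
  · rw [hu0 i hi, part_eq_zero l (hl.trans hi)]

/-! ### The eigenvalue equation as a recurrence -/

/-- The off-diagonal part of the action of the Laplace-Beltrami operator on coefficients. -/
def transfer {n : ℕ} (m : ℕ) (c : n.Partition → ℝ) (u : ℕ → ℕ) : ℝ :=
  ∑ j ∈ Finset.range m, ∑ i ∈ Finset.range j, ∑ t ∈ Finset.range (u j),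
    ((u i : ℝ) - u j + 2 * (t + 1)) * onParts c (shape m (move u i j (t + 1)))

/-- With positions counted from zero, entry `i` occurs once for each `j` with `i < j < m`, and `u (u
- 1) + (m - 1 - i) u = u (u - (i + 1)) + (m - 1) u`. -/
theorem sum_diagonal {n m : ℕ} (l : n.Partition) (hl : l.parts.card ≤ m) :
    ∑ j ∈ Finset.range m, (part l j : ℝ) * (part l j - 1) +
      ∑ j ∈ Finset.range m, ∑ i ∈ Finset.range j, (part l i : ℝ) =
    rho l + ((m : ℝ) - 1) * n := by
  have h : ∀ (u : ℕ → ℝ) (m : ℕ), ∑ j ∈ Finset.range m, u j * (u j - 1) +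
      ∑ j ∈ Finset.range m, ∑ i ∈ Finset.range j, u i =
      ∑ i ∈ Finset.range m, u i * (u i - (i + 1)) + (m - 1) * ∑ i ∈ Finset.range m, u i := by
    intro u m
    induction m with
    | zero => simp
    | succ m ih =>
      simp only [Finset.sum_range_succ]
      push_cast
      linear_combination ih
  rw [h, ← rho_eq_sum l hl, ← Nat.cast_sum, sum_part l hl]

/-- Used in both directions: from right to left to construct a zonal family, from left to right to
compute with one. -/
theorem eigen_iff {n m : ℕ} (κ : n.Partition) (c : n.Partition → ℝ) :
    (∀ y : Fin m → ℝ, Function.Injective y →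
      laplaceBeltrami (∑ l, c l • msymm (Fin m) ℝ l) y =
        (rho κ + ((m : ℝ) - 1) * n) * eval y (∑ l, c l • msymm (Fin m) ℝ l)) ↔
    ∀ l : n.Partition, l.parts.card ≤ m → (rho κ - rho l) * c l = transfer m c (part l) := by
  set f := ∑ l, c l • msymm (Fin m) ℝ l with hf
  have hsymm : f.IsSymmetric := isSymmetric_sum_smul_msymm c
  obtain ⟨D, hD, heval, hcoeff⟩ := exists_laplaceBeltrami hsymm
  have h1 : (∀ y : Fin m → ℝ, Function.Injective y →
      laplaceBeltrami f y = (rho κ + ((m : ℝ) - 1) * n) * eval y f) ↔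
      D = (rho κ + ((m : ℝ) - 1) * n) • f := by
    constructor
    · intro h
      rw [← sub_eq_zero]
      refine eq_zero_of_eval_injective fun y hy => ?_
      rw [map_sub, smul_eval, heval y hy, h y hy, sub_self]
    · intro h y hy
      rw [← heval y hy, h, smul_eval]
  have h2 : ∀ u, coeff (expo m u) D = (∑ j ∈ Finset.range m, (u j : ℝ) * (u j - 1) +
      ∑ j ∈ Finset.range m, ∑ i ∈ Finset.range j, (u i : ℝ)) * onParts c (shape m u) +
      transfer m c u := by
    intro u
    rw [hcoeff, hf]
    simp only [coeff_expo_sum_smul_msymm, transfer, Finset.sum_add_distrib, add_mul,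
      Finset.sum_mul, add_assoc]
  rw [h1]
  constructor
  · intro h l hl
    have h3 := h2 (part l)
    rw [h, coeff_smul, hf, coeff_expo_sum_smul_msymm, shape_part l hl, onParts_parts,
      sum_diagonal l hl, smul_eq_mul] at h3
    linear_combination h3
  · intro h
    refine ext_of_isSymmetric hD (hsymm.smul _) fun u hu hu0 => ?_
    rw [h2, coeff_smul, hf, coeff_expo_sum_smul_msymm, smul_eq_mul]
    by_cases hn : ∑ i ∈ Finset.range m, u i = n
    · obtain ⟨l, hl, rfl⟩ := exists_partition_of_antitone hu hu0 hn
      rw [sum_diagonal l hl, shape_part l hl, onParts_parts, ← h l hl]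
      ring
    -- In a degree other than `n` both sides vanish, since moving units preserves the degree.
    · rw [onParts_eq_zero c (by rwa [sum_shape]), mul_zero, mul_zero, zero_add]
      refine Finset.sum_eq_zero fun j hj => Finset.sum_eq_zero fun i hi =>
        Finset.sum_eq_zero fun t ht => ?_
      rw [onParts_eq_zero, mul_zero]
      rw [sum_shape]
      simp only [Finset.mem_range] at hj hi ht
      have := sum_move hi (show t + 1 ≤ u j by omega) m
      rw [if_pos hj, if_pos (hi.trans hj)] at this
      omega

/-! ### Existence of the zonal family -/

/-- The expansion of `(y₁ + ⋯ + y_m) ^ n` in monomial symmetric polynomials. -/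
theorem exists_pow_eq_sum_msymm (m n : ℕ) :
    ((∑ i, X i) ^ n : MvPolynomial (Fin m) ℝ) = ∑ l : n.Partition,
      coeff (expo m (part l)) ((∑ i, X i) ^ n : MvPolynomial (Fin m) ℝ) • msymm (Fin m) ℝ l := by
  have hs : ((∑ i, X i) ^ n : MvPolynomial (Fin m) ℝ).IsSymmetric := by
    rw [← psum_one]
    exact (symmetricSubalgebra (Fin m) ℝ).pow_mem (psum_isSymmetric (Fin m) ℝ 1) n
  refine ext_of_isSymmetric hs (isSymmetric_sum_smul_msymm _) fun u hu hu0 => ?_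
  rw [coeff_expo_sum_smul_msymm]
  by_cases hn : ∑ i ∈ Finset.range m, u i = n
  · obtain ⟨l, hl, rfl⟩ := exists_partition_of_antitone hu hu0 hn
    rw [shape_part l hl, onParts_parts]
  · have hne : (expo m u).sum (fun _ k => k) ≠ n := by
      rw [Finsupp.sum_fintype _ _ (fun _ => rfl)]
      rwa [Finset.sum_range] at hn
    rw [onParts_eq_zero _ (by rwa [sum_shape]), coeff_sum_X_pow_of_fintype, if_neg hne,
      Nat.cast_zero]

theorem exists_isZonalFamily (m n : ℕ) : ∃ C, IsZonalFamily m n C := by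
  classical
  -- The matrix of `transfer`, obtained by applying it to indicator functions. Partitions with more
  -- than `m` parts get zero rows, as the recurrence is required only up to `m` parts.
  let A : n.Partition → n.Partition → ℝ := fun l μ => if l.parts.card ≤ m then
    transfer m (fun ν => if ν = μ then 1 else 0) (part l) else 0
  have hon : ∀ (c : n.Partition → ℝ) (s : Multiset ℕ), onParts c s =
      ∑ μ, onParts (fun ν => if ν = μ then (1 : ℝ) else 0) s * c μ := by
    intro c s
    simp only [onParts, Finset.sum_mul]
    rw [Finset.sum_comm]
    refine Finset.sum_congr rfl fun l _ => ?_
    split_ifs <;> simp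
  have hA : ∀ (c : n.Partition → ℝ) (l : n.Partition), l.parts.card ≤ m →
      transfer m c (part l) = ∑ μ, A l μ * c μ := by
    intro c l hl
    simp only [A, if_pos hl, transfer, Finset.sum_mul]
    symm
    refine Finset.sum_comm.trans (Finset.sum_congr rfl fun j _ => ?_)
    refine Finset.sum_comm.trans (Finset.sum_congr rfl fun i _ => ?_)
    refine Finset.sum_comm.trans (Finset.sum_congr rfl fun t _ => ?_)
    rw [hon c, Finset.mul_sum]
    exact Finset.sum_congr rfl fun μ _ => by ring
  obtain ⟨c, hc1, hc2, hc3⟩ := exists_triangular_family Dominates Dominates.refl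
    (fun a b c => Dominates.trans) (rho (n := n)) (fun a b => Dominates.rho_lt) A (by
      intro l μ h
      simp only [A] at h
      split_ifs at h with hl
      · obtain ⟨j, hj, h⟩ := Finset.exists_ne_zero_of_sum_ne_zero h
        obtain ⟨i, hi, h⟩ := Finset.exists_ne_zero_of_sum_ne_zero h
        obtain ⟨t, ht, h⟩ := Finset.exists_ne_zero_of_sum_ne_zero h
        obtain ⟨ν, -, h⟩ := Finset.exists_ne_zero_of_sum_ne_zero (right_ne_zero_of_mul h)
        have h' : shape m (move (part l) i j (t + 1)) = ν.parts ∧ ν = μ := by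
          by_contra hc
          apply h
          rw [not_and] at hc
          split_ifs with h1
          · exact if_neg (hc h1)
          · rfl
        obtain ⟨h', rfl⟩ := h'
        simp only [Finset.mem_range] at hj hi ht
        exact dominates_of_shape_move hl hi hj (by omega) (by omega) h'
      · exact absurd rfl h)
    (fun l => coeff (expo m (part l)) ((∑ i, X i) ^ n : MvPolynomial (Fin m) ℝ))
  refine ⟨fun κ => ∑ l, c κ l • msymm (Fin m) ℝ l, fun κ => ?_, fun κ => ?_, ?_⟩
  · refine Submodule.sum_mem _ fun l _ => ?_
    by_cases h : c κ l = 0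
    · rw [h, zero_smul]; exact Submodule.zero_mem _
    · exact Submodule.smul_mem _ _ (Submodule.subset_span ⟨l, hc1 _ _ h, rfl⟩)
  · rw [eigen_iff]
    intro l hl
    rw [hc2, hA _ l hl]
  · rw [Finset.sum_comm, exists_pow_eq_sum_msymm]
    refine Finset.sum_congr rfl fun l _ => ?_
    rw [← Finset.sum_smul, hc3]

theorem isZonalFamily_zonalPoly (m n : ℕ) : IsZonalFamily m n (zonalPoly m) := by
  have := Classical.epsilon_spec (exists_isZonalFamily m n)
  exact this

/-- The defining properties of the coefficients of the zonal polynomials in the monomial symmetric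
polynomials in `m` variables. -/
structure IsCoefficients (m n : ℕ) (c : n.Partition → n.Partition → ℝ) : Prop where
  eq_zero : ∀ κ l, ¬ Dominates κ l → c κ l = 0
  recurrence : ∀ κ l, l.parts.card ≤ m → (rho κ - rho l) * c κ l = transfer m (c κ) (part l)
  sum_eq : ∀ l, l.parts.card ≤ m →
    ∑ κ, c κ l = coeff (expo m (part l)) ((∑ i, X i) ^ n : MvPolynomial (Fin m) ℝ)

/-- From here on only the three properties in `IsCoefficients` matter, so the results hold for
whichever zonal family was chosen. -/
theorem exists_isCoefficients (m n : ℕ) : ∃ c : n.Partition → n.Partition → ℝ,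
    IsCoefficients m n c ∧ ∀ κ l, l.parts.card ≤ m → zonalCoeff m κ l = c κ l := by
  classical
  have hZ := isZonalFamily_zonalPoly m n
  have h1 : ∀ κ : n.Partition, ∃ c : n.Partition → ℝ, (∀ l, ¬ Dominates κ l → c l = 0) ∧
      zonalPoly m κ = ∑ l, c l • msymm (Fin m) ℝ l := by
    intro κ
    obtain ⟨a, ha, hκ⟩ := (Finsupp.mem_span_image_iff_linearCombination ℝ).1 (hZ.mem_span κ)
    refine ⟨a, fun l hl => ?_, ?_⟩
    · rw [Finsupp.mem_supported] at ha
      by_contra h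
      exact hl (ha (Finsupp.mem_support_iff.2 h))
    · rw [← hκ, Finsupp.linearCombination_apply, Finsupp.sum_fintype _ _ (by simp)]
  choose c hc hC using h1
  have hcoeff : ∀ κ l, l.parts.card ≤ m → coeff (expo m (part l)) (zonalPoly m κ) = c κ l := by
    intro κ l hl
    rw [hC, coeff_expo_sum_smul_msymm, shape_part l hl, onParts_parts]
  refine ⟨c, ⟨hc, fun κ => ?_, fun l hl => ?_⟩, hcoeff⟩
  · rw [← eigen_iff, ← hC]
    exact hZ.eigen κ
  · rw [← hZ.sum_eq, coeff_sum]
    exact Finset.sum_congr rfl fun κ _ => (hcoeff κ l hl).symm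

/-! ### Partitions with at most three parts -/

/-- The sequence `a, b, d, 0, 0, …`. -/
def triple (a b d : ℕ) : ℕ → ℕ
  | 0 => a
  | 1 => b
  | 2 => d
  | _ => 0

theorem card_le_of_part_eq_zero {n : ℕ} {l : n.Partition} {i : ℕ} (h : part l i = 0) :
    l.parts.card ≤ i := by
  by_contra! hc
  have : part l i ∈ (Multiset.range l.parts.card).map (part l) :=
    Multiset.mem_map_of_mem _ (Multiset.mem_range.2 hc)
  rw [map_part] at this
  exact (l.parts_pos this).ne' h

theorem card_le_three {n a b d : ℕ} {l : n.Partition} (h : part l = triple a b d) :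
    l.parts.card ≤ 3 :=
  card_le_of_part_eq_zero (by rw [h]; rfl)

theorem sum_triple {n a b d : ℕ} {l : n.Partition} (h : part l = triple a b d) :
    a + b + d = n := by
  rw [← sum_part l (card_le_three h), h]
  simp [Finset.sum_range_succ, triple]

theorem part_eq_triple {n a b d : ℕ} {l : n.Partition} (hab : b ≤ a) (hbd : d ≤ b)
    (h : l.parts = shape 3 (triple a b d)) : part l = triple a b d := by
  have h3 : l.parts.card ≤ 3 := h ▸ card_shape_le _ _
  ext i
  rcases lt_or_ge i 3 with hi | hi
  · refine part_eq_of_shape h.symm (fun i j hij hj => ?_) hi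
    interval_cases j <;> interval_cases i <;> simp [triple] <;> omega
  · rw [part_eq_zero l (h3.trans hi)]
    match i, hi with
    | i + 3, _ => rfl

theorem exists_part_eq_triple {n a b d : ℕ} (hab : b ≤ a) (hbd : d ≤ b) (h : a + b + d = n) :
    ∃ l : n.Partition, part l = triple a b d :=
  ⟨⟨shape 3 (triple a b d), fun {i} hi => Nat.pos_of_ne_zero (Multiset.mem_filter.1 hi).2, by
    rw [sum_shape]; simpa [Finset.sum_range_succ, triple] using h⟩, part_eq_triple hab hbd rfl⟩

theorem rho_eq_of_triple {n a b d : ℕ} {l : n.Partition} (h : part l = triple a b d) :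
    rho l = (a : ℝ) * (a - 1) + b * (b - 2) + d * (d - 3) := by
  rw [rho_eq_sum l (card_le_three h), h]
  simp [Finset.sum_range_succ, triple]
  ring

theorem onParts_triple {n a b d : ℕ} (c : n.Partition → ℝ) {l : n.Partition}
    (h : part l = triple a b d) : onParts c (shape 3 (triple a b d)) = c l := by
  rw [← h, shape_part l (card_le_three h), onParts_parts]

theorem shape_triple_zero (a b : ℕ) : shape 3 (triple a 0 b) = shape 3 (triple a b 0) := by
  simp [shape, triple, Multiset.range_succ, Multiset.filter_cons]

/-- A zero entry has no units to give, so trailing zeros contribute nothing. This is why the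
coefficients do not depend on `m`. -/
theorem transfer_eq_of_le {n k m : ℕ} (h : k ≤ m) (c : n.Partition → ℝ) {u : ℕ → ℕ}
    (hu : ∀ i, k ≤ i → u i = 0) : transfer m c u = transfer k c u := by
  have h1 : transfer m c u = ∑ j ∈ Finset.range k, ∑ i ∈ Finset.range j, ∑ t ∈ Finset.range (u j),
      ((u i : ℝ) - u j + 2 * (t + 1)) * onParts c (shape m (move u i j (t + 1))) := by
    symm
    refine Finset.sum_subset (by simpa using h) fun j _ hj => ?_
    simp [hu j (by simpa using hj)]
  rw [h1]
  refine Finset.sum_congr rfl fun j hj => Finset.sum_congr rfl fun i hi => ?_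
  refine Finset.sum_congr rfl fun t _ => ?_
  rw [shape_eq_of_le h]
  intro x hx
  simp only [Finset.mem_range] at hi hj
  rw [move, if_neg (by omega), if_neg (by omega), hu x hx]

theorem transfer_part_eq_transfer_three {n m a b d : ℕ} (c : n.Partition → ℝ) {l : n.Partition}
    (hl : l.parts.card ≤ m) (h : part l = triple a b d) :
    transfer m c (part l) = transfer 3 c (triple a b d) := by
  have h0 : ∀ i, l.parts.card ≤ i → part l i = 0 := fun i => part_eq_zero l
  -- The passage goes through the number of parts of `l`, because `m` itself may be smaller than
  -- three.
  rw [transfer_eq_of_le hl c h0, ← transfer_eq_of_le (card_le_three h) c h0, h]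

theorem transfer_three {n : ℕ} (c : n.Partition → ℝ) (a b d : ℕ) :
    transfer 3 c (triple a b d) =
      ∑ t ∈ Finset.range b, ((a : ℝ) - b + 2 * (t + 1)) *
        onParts c (shape 3 (triple (a + (t + 1)) (b - (t + 1)) d)) +
      (∑ t ∈ Finset.range d, ((a : ℝ) - d + 2 * (t + 1)) *
        onParts c (shape 3 (triple (a + (t + 1)) b (d - (t + 1)))) +
      ∑ t ∈ Finset.range d, ((b : ℝ) - d + 2 * (t + 1)) *
        onParts c (shape 3 (triple a (b + (t + 1)) (d - (t + 1))))) := by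
  have h1 : ∀ t, shape 3 (move (triple a b d) 0 1 t) = shape 3 (triple (a + t) (b - t) d) :=
    fun t => rfl
  have h2 : ∀ t, shape 3 (move (triple a b d) 0 2 t) = shape 3 (triple (a + t) b (d - t)) :=
    fun t => rfl
  have h3 : ∀ t, shape 3 (move (triple a b d) 1 2 t) = shape 3 (triple a (b + t) (d - t)) :=
    fun t => rfl
  simp only [transfer, Finset.sum_range_succ _ 2, Finset.sum_range_succ _ 1,
    Finset.sum_range_succ _ 0, Finset.sum_range_zero, zero_add, h1, h2, h3]
  rfl

theorem exists_triple_of_dominates {n a b d : ℕ} {κ l : n.Partition} (h : Dominates κ l)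
    (hl : part l = triple a b d) : ∃ x y z, part κ = triple x y z ∧ y ≤ x ∧ z ≤ y ∧
      x + y + z = n ∧ a ≤ x ∧ a + b ≤ x + y := by
  have h1 := h 1
  have h2 := h 2
  have h3 := h 3
  have hn := sum_triple hl
  simp only [hl, Finset.sum_range_succ, Finset.sum_range_zero, zero_add, triple] at h1 h2 h3
  -- Dominance at `k = 3` gives the first three parts of `κ` a sum of at least `n`, which leaves
  -- nothing for a fourth.
  have hz : part κ 3 = 0 := by
    have h4 := sum_part κ (le_max_left κ.parts.card 4)
    have h5 : ∑ i ∈ Finset.range 4, part κ i ≤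
        ∑ i ∈ Finset.range (max κ.parts.card 4), part κ i :=
      Finset.sum_le_sum_of_subset (by simp)
    simp only [Finset.sum_range_succ, Finset.sum_range_zero, zero_add] at h5
    omega
  have hκ : part κ = triple (part κ 0) (part κ 1) (part κ 2) := by
    ext i
    match i with
    | 0 => rfl
    | 1 => rfl
    | 2 => rfl
    | i + 3 => exact part_eq_zero κ ((card_le_of_part_eq_zero hz).trans (by omega))
  exact ⟨_, _, _, hκ, part_antitone κ (by omega), part_antitone κ (by omega), sum_triple hκ,
    h1, h2⟩

theorem eq_of_triple {n a b d x y z : ℕ} {κ l : n.Partition} (hκ : part κ = triple x y z)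
    (hl : part l = triple a b d) (h1 : x = a) (h2 : y = b) (h3 : z = d) : κ = l := by
  subst h1 h2 h3
  exact ext_part fun i => by rw [hκ, hl]

theorem ne_of_triple {n a b d x y z : ℕ} {κ l : n.Partition} (hκ : part κ = triple x y z)
    (hl : part l = triple a b d) (h : x ≠ a ∨ y ≠ b) : κ ≠ l := by
  rintro rfl
  rw [hκ] at hl
  have h0 : x = a := congrFun hl 0
  have h1 : y = b := congrFun hl 1
  omega

theorem coeff_pow_mul_factorial {n m a b d : ℕ} {l : n.Partition} (hl : l.parts.card ≤ m)
    (h : part l = triple a b d) :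
    coeff (expo m (part l)) ((∑ i, X i) ^ n : MvPolynomial (Fin m) ℝ) *
      (a.factorial * b.factorial * d.factorial) = n.factorial := by
  have hs : ∑ i : Fin m, part l i = n := by
    rw [← Finset.sum_range, sum_part l hl]
  have hs' : (expo m (part l)).sum (fun _ k => k) = n := by
    rw [Finsupp.sum_fintype _ _ (fun _ => rfl)]
    exact hs
  rw [coeff_sum_X_pow_of_fintype, if_pos hs',
    Finsupp.multinomial_eq_of_support_subset (Finset.subset_univ _)]
  have h1 := Nat.multinomial_spec Finset.univ (expo m (part l))
  have h2 : ∏ i : Fin m, (expo m (part l) i).factorial =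
      a.factorial * b.factorial * d.factorial := by
    change ∏ i : Fin m, (part l i).factorial = _
    rw [← Finset.prod_range fun i => (part l i).factorial]
    have key : ∀ N, l.parts.card ≤ N → ∏ i ∈ Finset.range N, (part l i).factorial =
        ∏ i ∈ Finset.range l.parts.card, (part l i).factorial := by
      intro N hN
      symm
      refine Finset.prod_subset (by simpa using hN) fun i _ hi => ?_
      rw [part_eq_zero l (by simpa using hi), Nat.factorial_zero]
    rw [key m hl, ← key 3 (card_le_three h), h]
    simp [Finset.prod_range_succ, triple]
  rw [h2] at h1
  have h3 : ∑ i : Fin m, expo m (part l) i = n := hs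
  rw [h3] at h1
  rw [mul_comm]
  exact_mod_cast h1

/-! ### The recurrence for the partitions in the table -/

namespace IsCoefficients

variable {m n : ℕ} {c : n.Partition → n.Partition → ℝ}

theorem eq_zero_of_triple (hc : IsCoefficients m n c) {κ l : n.Partition} {a b d x y z : ℕ}
    (hκ : part κ = triple x y z) (hl : part l = triple a b d) (h : x < a ∨ x + y < a + b) :
    c κ l = 0 := by
  apply hc.eq_zero
  intro hd
  have h1 := hd 1
  have h2 := hd 2
  simp only [hκ, hl, Finset.sum_range_succ, Finset.sum_range_zero, zero_add, triple] at h1 h2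
  omega

/-- Partitions that do not dominate `l` contribute zero, so a short list `S` suffices. Once the
other entries of a column are known, this yields the diagonal one. -/
theorem sum_mul_factorial (hc : IsCoefficients m n c) {l : n.Partition} {a b d : ℕ}
    (hm : l.parts.card ≤ m) (hl : part l = triple a b d) (S : Finset n.Partition)
    (hS : ∀ κ, Dominates κ l → κ ∈ S) :
    (∑ κ ∈ S, c κ l) * (a.factorial * b.factorial * d.factorial) = n.factorial := by
  rw [Finset.sum_subset (Finset.subset_univ S)
    fun κ _ h => hc.eq_zero κ l fun hd => h (hS κ hd), hc.sum_eq l hm,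
    coeff_pow_mul_factorial hm hl]

theorem recurrence_triple (hc : IsCoefficients m n c) (κ : n.Partition) {l : n.Partition}
    {a b d : ℕ} (hm : l.parts.card ≤ m) (hl : part l = triple a b d) :
    (rho κ - (a * (a - 1) + b * (b - 2) + d * (d - 3))) * c κ l =
      ∑ t ∈ Finset.range b, ((a : ℝ) - b + 2 * (t + 1)) *
        onParts (c κ) (shape 3 (triple (a + (t + 1)) (b - (t + 1)) d)) +
      (∑ t ∈ Finset.range d, ((a : ℝ) - d + 2 * (t + 1)) *
        onParts (c κ) (shape 3 (triple (a + (t + 1)) b (d - (t + 1)))) +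
      ∑ t ∈ Finset.range d, ((b : ℝ) - d + 2 * (t + 1)) *
        onParts (c κ) (shape 3 (triple a (b + (t + 1)) (d - (t + 1))))) := by
  rw [← transfer_three, ← transfer_part_eq_transfer_three _ hm hl, ← hc.recurrence κ l hm,
    rho_eq_of_triple hl]

variable {a : ℕ} {k₁ k₂ k₃ k₄ k₅ k₆ : n.Partition}

theorem recurrence_one (hc : IsCoefficients m n c) (κ : n.Partition)
    (h₁ : part k₁ = triple (a + 1) 0 0) (h₂ : part k₂ = triple a 1 0) (hm : k₂.parts.card ≤ m) :
    (rho κ - (a * (a - 1) - 1)) * c κ k₂ = (a + 1) * c κ k₁ := by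
  have h := hc.recurrence_triple κ hm h₂
  simp only [Finset.sum_range_succ, Finset.sum_range_zero, zero_add, Nat.sub_self,
    onParts_triple _ h₁] at h
  push_cast at h
  linear_combination h

theorem recurrence_two (hc : IsCoefficients m n c) (κ : n.Partition)
    (h₁ : part k₁ = triple (a + 2) 0 0) (h₂ : part k₂ = triple (a + 1) 1 0)
    (h₃ : part k₃ = triple a 2 0) (hm : k₃.parts.card ≤ m) :
    (rho κ - a * (a - 1)) * c κ k₃ = a * c κ k₂ + (a + 2) * c κ k₁ := by
  have h := hc.recurrence_triple κ hm h₃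
  simp only [Finset.sum_range_succ, Finset.sum_range_zero, zero_add, Nat.sub_self,
    onParts_triple _ h₁, onParts_triple _ h₂, Nat.reduceAdd, Nat.reduceSub] at h
  push_cast at h
  linear_combination h

/-- Moving a unit to the first part from the second or from the third gives `(a + 1, 1)` after
sorting, hence the factor `2`. -/
theorem recurrence_one_one (hc : IsCoefficients m n c) (κ : n.Partition)
    (h₂ : part k₂ = triple (a + 1) 1 0) (h₃ : part k₃ = triple a 2 0)
    (h₄ : part k₄ = triple a 1 1) (hm : k₄.parts.card ≤ m) :
    (rho κ - (a * (a - 1) - 3)) * c κ k₄ = 2 * (a + 1) * c κ k₂ + 2 * c κ k₃ := by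
  have h := hc.recurrence_triple κ hm h₄
  simp only [Finset.sum_range_succ, Finset.sum_range_zero, zero_add, Nat.sub_self,
    shape_triple_zero, onParts_triple _ h₂, onParts_triple _ h₃, Nat.reduceAdd] at h
  push_cast at h
  linear_combination h

theorem recurrence_three (hc : IsCoefficients m n c) (κ : n.Partition)
    (h₁ : part k₁ = triple (a + 3) 0 0) (h₂ : part k₂ = triple (a + 2) 1 0)
    (h₃ : part k₃ = triple (a + 1) 2 0) (h₅ : part k₅ = triple a 3 0) (hm : k₅.parts.card ≤ m) :
    (rho κ - (a * (a - 1) + 3)) * c κ k₅ =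
      (a - 1) * c κ k₃ + (a + 1) * c κ k₂ + (a + 3) * c κ k₁ := by
  have h := hc.recurrence_triple κ hm h₅
  simp only [Finset.sum_range_succ, Finset.sum_range_zero, zero_add, Nat.sub_self,
    onParts_triple _ h₁, onParts_triple _ h₂, onParts_triple _ h₃, Nat.reduceAdd,
    Nat.reduceSub] at h
  push_cast at h
  linear_combination h

theorem recurrence_two_one (hc : IsCoefficients m n c) (κ : n.Partition)
    (h₂ : part k₂ = triple (a + 2) 1 0) (h₃ : part k₃ = triple (a + 1) 2 0)
    (h₄ : part k₄ = triple (a + 1) 1 1) (h₅ : part k₅ = triple a 3 0)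
    (h₆ : part k₆ = triple a 2 1) (hm : k₆.parts.card ≤ m) :
    (rho κ - (a * (a - 1) - 2)) * c κ k₆ =
      a * c κ k₄ + (a + 2) * c κ k₂ + (a + 1) * c κ k₃ + 3 * c κ k₅ := by
  have h := hc.recurrence_triple κ hm h₆
  simp only [Finset.sum_range_succ, Finset.sum_range_zero, zero_add, Nat.sub_self,
    shape_triple_zero, onParts_triple _ h₂, onParts_triple _ h₃, onParts_triple _ h₄,
    onParts_triple _ h₅, Nat.reduceAdd, Nat.reduceSub] at h
  push_cast at h
  linear_combination h

/-! ### The columns of the table -/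

theorem column_one (hc : IsCoefficients m n c) (h₁ : part k₁ = triple n 0 0)
    (hm : k₁.parts.card ≤ m) : c k₁ k₁ = 1 := by
  have h := hc.sum_mul_factorial hm h₁ {k₁} fun κ hκ => by
    obtain ⟨x, y, z, hx, h⟩ := exists_triple_of_dominates hκ h₁
    rw [eq_of_triple hx h₁ (by omega) (by omega) (by omega)]
    simp
  have h0 : (n.factorial : ℝ) ≠ 0 := by positivity
  simpa [h0] using h

/-- The pattern of all later columns: the recurrence, with gap `ρ_{(n)} - ρ_{(n-1,1)} = 2n - 1`,
gives the entry above the diagonal, and the multinomial coefficient `n` minus that entry is the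
diagonal one. -/
theorem column_two (hc : IsCoefficients m n c) (h₁ : part k₁ = triple n 0 0)
    (h₂ : part k₂ = triple (n - 1) 1 0) (hn : 2 ≤ n) (hm : 2 ≤ m) :
    c k₁ k₂ = n / (2 * n - 1) ∧ c k₂ k₂ = 2 * (n - 1) * n / (2 * n - 1) := by
  obtain ⟨a, rfl⟩ := Nat.exists_eq_add_of_le' (show 1 ≤ n by omega)
  simp only [Nat.add_sub_cancel] at h₂
  have hm₁ : k₁.parts.card ≤ m := (card_le_of_part_eq_zero (by rw [h₁]; rfl)).trans hm
  have hm₂ : k₂.parts.card ≤ m := (card_le_of_part_eq_zero (by rw [h₂]; rfl)).trans hm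
  have hs := hc.sum_mul_factorial hm₂ h₂ {k₁, k₂} fun κ hκ => by
    obtain ⟨x, y, z, hx, h⟩ := exists_triple_of_dominates hκ h₂
    have : x = a ∧ y = 1 ∧ z = 0 ∨ x = a + 1 ∧ y = 0 ∧ z = 0 := by omega
    rcases this with ⟨rfl, rfl, rfl⟩ | ⟨rfl, rfl, rfl⟩
    · simp [eq_of_triple hx h₂ rfl rfl rfl]
    · simp [eq_of_triple hx h₁ rfl rfl rfl]
  rw [Finset.sum_pair (ne_of_triple h₁ h₂ (by omega)), Nat.factorial_succ] at hs
  have hr := hc.recurrence_one k₁ h₁ h₂ hm₂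
  rw [hc.column_one h₁ hm₁, rho_eq_of_triple h₁] at hr
  have hf : (a.factorial : ℝ) ≠ 0 := by positivity
  replace hs : c k₁ k₂ + c k₂ k₂ = a + 1 := by
    apply mul_right_cancel₀ hf
    push_cast [Nat.factorial] at hs
    linear_combination hs
  push_cast at hr ⊢
  have h0 : 2 * ((a : ℝ) + 1) - 1 ≠ 0 := by
    have : (0 : ℝ) ≤ a := by positivity
    linarith
  have e : c k₁ k₂ = (a + 1) / (2 * (a + 1) - 1) := by
    rw [eq_div_iff h0]; linear_combination hr
  refine ⟨e, ?_⟩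
  rw [show c k₂ k₂ = a + 1 - c k₁ k₂ by linear_combination hs, e]
  have h0' : ((a : ℝ) + 1) * 2 - 1 ≠ 0 := by rwa [mul_comm]
  field_simp
  ring

theorem column_three (hc : IsCoefficients m n c) (h₁ : part k₁ = triple n 0 0)
    (h₂ : part k₂ = triple (n - 1) 1 0) (h₃ : part k₃ = triple (n - 2) 2 0) (hn : 4 ≤ n)
    (hm : 2 ≤ m) :
    c k₁ k₃ = 3 * (n - 1) * n / (2 * (2 * n - 3) * (2 * n - 1)) ∧
    c k₂ k₃ = 2 * (n - 2) * (n - 1) * n / ((2 * n - 5) * (2 * n - 1)) ∧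
    c k₃ k₃ = 2 * (n - 3) * (n - 2) * (n - 1) * n / ((2 * n - 5) * (2 * n - 3)) := by
  obtain ⟨e₁₂, e₂₂⟩ := hc.column_two h₁ h₂ (by omega) hm
  have e₁₁ := hc.column_one h₁ ((card_le_of_part_eq_zero (i := 2) (by rw [h₁]; rfl)).trans hm)
  obtain ⟨a, rfl⟩ := Nat.exists_eq_add_of_le' (show 2 ≤ n by omega)
  simp only [Nat.reduceSubDiff, Nat.add_sub_cancel] at h₂ h₃
  -- Making the cast of `n` an opaque real lets the remaining algebra be rational identities in `N`,
  -- free of natural-number subtraction.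
  obtain ⟨N, hN⟩ : ∃ N : ℝ, N = ((a + 2 : ℕ) : ℝ) := ⟨_, rfl⟩
  rw [← hN] at e₁₂ e₂₂
  have hm₃ : k₃.parts.card ≤ m := (card_le_of_part_eq_zero (by rw [h₃]; rfl)).trans hm
  have hs := hc.sum_mul_factorial hm₃ h₃ {k₁, k₂, k₃} fun κ hκ => by
    obtain ⟨x, y, z, hx, h⟩ := exists_triple_of_dominates hκ h₃
    have : x = a ∧ y = 2 ∧ z = 0 ∨ x = a + 1 ∧ y = 1 ∧ z = 0 ∨ x = a + 2 ∧ y = 0 ∧ z = 0 := by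
      omega
    rcases this with ⟨rfl, rfl, rfl⟩ | ⟨rfl, rfl, rfl⟩ | ⟨rfl, rfl, rfl⟩
    · simp [eq_of_triple hx h₃ rfl rfl rfl]
    · simp [eq_of_triple hx h₂ rfl rfl rfl]
    · simp [eq_of_triple hx h₁ rfl rfl rfl]
  rw [Finset.sum_insert (by simp [ne_of_triple h₁ h₂, ne_of_triple h₁ h₃]),
    Finset.sum_pair (ne_of_triple h₂ h₃ (by omega))] at hs
  have hr₁ := hc.recurrence_two k₁ h₁ h₂ h₃ hm₃
  have hr₂ := hc.recurrence_two k₂ h₁ h₂ h₃ hm₃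
  rw [hc.eq_zero_of_triple h₂ h₁ (by omega), e₂₂, rho_eq_of_triple h₂] at hr₂
  rw [e₁₁, e₁₂, rho_eq_of_triple h₁] at hr₁
  have hf : (a.factorial : ℝ) ≠ 0 := by positivity
  replace hs : c k₁ k₃ + (c k₂ k₃ + c k₃ k₃) = (a + 2) * (a + 1) / 2 := by
    apply mul_right_cancel₀ hf
    push_cast [Nat.factorial] at hs
    linear_combination hs / 2
  have ha : (a : ℝ) = N - 2 := by rw [hN]; push_cast; ring
  have hN4 : (4 : ℝ) ≤ N := by rw [hN]; exact_mod_cast hn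
  push_cast at hr₁ hr₂
  rw [← hN]
  rw [ha] at hr₁ hr₂ hs
  have d1 : N * 2 - 1 ≠ 0 := by linarith
  have d1' : 2 * N - 1 ≠ 0 := by linarith
  have d3 : N * 2 - 3 ≠ 0 := by linarith
  have d3' : 2 * N - 3 ≠ 0 := by linarith
  have d5 : N * 2 - 5 ≠ 0 := by linarith
  have d5' : 2 * N - 5 ≠ 0 := by linarith
  -- Here the gap of `ρ` is `4N - 6 = 2 (2N - 3)`; the constant `2` has been divided out.
  have e₁ : c k₁ k₃ = 3 * (N - 1) * N / (2 * (2 * N - 3) * (2 * N - 1)) := by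
    apply mul_left_cancel₀ (show 2 * N - 3 ≠ 0 by linarith)
    rw [show (2 * N - 3) * c k₁ k₃ = ((N - 2) * (N / (2 * N - 1)) + N) / 2 by
      linear_combination hr₁ / 2]
    field_simp
    ring
  have e₂ : c k₂ k₃ = 2 * (N - 2) * (N - 1) * N / ((2 * N - 5) * (2 * N - 1)) := by
    apply mul_left_cancel₀ (show 2 * N - 5 ≠ 0 by linarith)
    rw [show (2 * N - 5) * c k₂ k₃ = (N - 2) * (2 * (N - 1) * N / (2 * N - 1)) by
      linear_combination hr₂]
    field_simp
  refine ⟨e₁, e₂, ?_⟩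
  rw [show c k₃ k₃ = N * (N - 1) / 2 - c k₁ k₃ - c k₂ k₃ by linear_combination hs, e₁, e₂]
  field_simp
  ring

/-- The gaps of `ρ` are `4n - 3`, `2 (n - 1)` and `3`. The factors `4n - 3` and `n - 1` cancel
against the right sides, so neither appears in a denominator. -/
theorem column_four (hc : IsCoefficients m n c)
    (h₁ : part k₁ = triple n 0 0)
    (h₂ : part k₂ = triple (n - 1) 1 0)
    (h₃ : part k₃ = triple (n - 2) 2 0)
    (h₄ : part k₄ = triple (n - 2) 1 1)
    (hn : 6 ≤ n) (hm : 3 ≤ m) :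
    c k₁ k₄ = (n - 1) * n / ((2 * n - 3) * (2 * n - 1)) ∧
    c k₂ k₄ = 2 * n * (2 * n ^ 2 - 6 * n + 3) / ((2 * n - 5) * (2 * n - 1)) ∧
    c k₃ k₄ = 4 * (n - 3) * (n - 2) * (n - 1) * n / (3 * (2 * n - 5) * (2 * n - 3)) ∧
    c k₄ k₄ = 2 / 3 * (n - 2) * n := by
  obtain ⟨e₁₂, e₂₂⟩ := hc.column_two h₁ h₂ (by omega) (by omega)
  obtain ⟨e₁₃, e₂₃, e₃₃⟩ := hc.column_three h₁ h₂ h₃ (by omega) (by omega)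
  have e₃₂ := hc.eq_zero_of_triple h₃ h₂ (by omega)
  obtain ⟨a, rfl⟩ := Nat.exists_eq_add_of_le' (show 2 ≤ n by omega)
  simp only [Nat.reduceSubDiff, Nat.add_sub_cancel] at h₂ h₃ h₄
  obtain ⟨N, hN⟩ : ∃ N : ℝ, N = ((a + 2 : ℕ) : ℝ) := ⟨_, rfl⟩
  rw [← hN] at e₁₂ e₂₂ e₁₃ e₂₃ e₃₃
  have hm' : k₄.parts.card ≤ m := (card_le_of_part_eq_zero (by rw [h₄]; rfl)).trans hm
  have hs := hc.sum_mul_factorial hm' h₄ {k₁, k₂, k₃, k₄} fun κ hκ => by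
    obtain ⟨x, y, z, hx, h⟩ := exists_triple_of_dominates hκ h₄
    have : x = a + 2 ∧ y = 0 ∧ z = 0 ∨
        x = a + 1 ∧ y = 1 ∧ z = 0 ∨
        x = a ∧ y = 2 ∧ z = 0 ∨
        x = a ∧ y = 1 ∧ z = 1 := by omega
    rcases this with ⟨rfl, rfl, rfl⟩ | ⟨rfl, rfl, rfl⟩ | ⟨rfl, rfl, rfl⟩ | ⟨rfl, rfl, rfl⟩
    · simp [eq_of_triple hx h₁ rfl rfl rfl]
    · simp [eq_of_triple hx h₂ rfl rfl rfl]
    · simp [eq_of_triple hx h₃ rfl rfl rfl]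
    · simp [eq_of_triple hx h₄ rfl rfl rfl]
  rw [Finset.sum_insert (by simp [ne_of_triple h₁ h₂, ne_of_triple h₁ h₃, ne_of_triple h₁ h₄]),
    Finset.sum_insert (by simp [ne_of_triple h₂ h₃, ne_of_triple h₂ h₄]),
    Finset.sum_pair (ne_of_triple h₃ h₄ (by omega))] at hs
  have hr₁ := hc.recurrence_one_one k₁ h₂ h₃ h₄ hm'
  have hr₂ := hc.recurrence_one_one k₂ h₂ h₃ h₄ hm'
  have hr₃ := hc.recurrence_one_one k₃ h₂ h₃ h₄ hm'
  rw [e₁₂, e₁₃, rho_eq_of_triple h₁] at hr₁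
  rw [e₂₂, e₂₃, rho_eq_of_triple h₂] at hr₂
  rw [e₃₂, e₃₃, rho_eq_of_triple h₃] at hr₃
  have hf : (a.factorial : ℝ) ≠ 0 := by positivity
  replace hs : c k₁ k₄ + (c k₂ k₄ + (c k₃ k₄ + (c k₄ k₄))) =
      (a + 2) * (a + 1) := by
    apply mul_right_cancel₀ hf
    push_cast [Nat.factorial] at hs
    linear_combination hs
  have ha : (a : ℝ) = N - 2 := by rw [hN]; push_cast; ring
  have hN6 : (6 : ℝ) ≤ N := by rw [hN]; exact_mod_cast hn
  push_cast at hr₁ hr₂ hr₃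
  rw [← hN]
  rw [ha] at hr₁ hr₂ hr₃ hs
  have d1 : N * 2 - 1 ≠ 0 := by linarith
  have d1' : 2 * N - 1 ≠ 0 := by linarith
  have d3 : N * 2 - 3 ≠ 0 := by linarith
  have d3' : 2 * N - 3 ≠ 0 := by linarith
  have d5 : N * 2 - 5 ≠ 0 := by linarith
  have d5' : 2 * N - 5 ≠ 0 := by linarith
  have d7 : N * 2 - 7 ≠ 0 := by linarith
  have d7' : 2 * N - 7 ≠ 0 := by linarith
  have d9 : N * 2 - 9 ≠ 0 := by linarith
  have d9' : 2 * N - 9 ≠ 0 := by linarith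
  have e₁ : c k₁ k₄ =
      (N - 1) * N / ((2 * N - 3) * (2 * N - 1)) := by
    have d : 4 * N - 3 ≠ 0 := by linarith
    apply mul_left_cancel₀ d
    rw [show (4 * N - 3) * c k₁ k₄ =
      2 * (N - 1) * (N / (2 * N - 1)) +
      2 * (3 * (N - 1) * N / (2 * (2 * N - 3) * (2 * N - 1))) by
      linear_combination hr₁]
    field_simp
    ring
  have e₂ : c k₂ k₄ =
      2 * N * (2 * N ^ 2 - 6 * N + 3) / ((2 * N - 5) * (2 * N - 1)) := by
    have d : N - 1 ≠ 0 := by linarith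
    apply mul_left_cancel₀ d
    rw [show (N - 1) * c k₂ k₄ =
      (2 * (N - 1) * (2 * (N - 1) * N / (2 * N - 1)) +
      2 * (2 * (N - 2) * (N - 1) * N / ((2 * N - 5) * (2 * N - 1)))) / 2 by
      linear_combination hr₂ / 2]
    field_simp
    ring
  have e₃ : c k₃ k₄ =
      4 * (N - 3) * (N - 2) * (N - 1) * N / (3 * (2 * N - 5) * (2 * N - 3)) := by
    have d : (3 : ℝ) ≠ 0 := by norm_num
    apply mul_left_cancel₀ d
    rw [show (3) * c k₃ k₄ =
      2 * (2 * (N - 3) * (N - 2) * (N - 1) * N / ((2 * N - 5) * (2 * N - 3))) by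
      linear_combination hr₃]
    field_simp
    ring
  refine ⟨e₁, e₂, e₃, ?_⟩
  rw [show c k₄ k₄ = N * (N - 1) - c k₁ k₄ - c k₂ k₄ - c k₃ k₄ by
    linear_combination hs, e₁, e₂, e₃]
  field_simp
  ring

/-- The partition `(n-2,1,1)` does not dominate `(n-3,3)` and is absent here. The gaps of `ρ` are `3
(2n - 5)`, `2 (2n - 7)` and `2n - 9`. -/
theorem column_five (hc : IsCoefficients m n c)
    (h₁ : part k₁ = triple n 0 0)
    (h₂ : part k₂ = triple (n - 1) 1 0)
    (h₃ : part k₃ = triple (n - 2) 2 0)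
    (h₅ : part k₅ = triple (n - 3) 3 0)
    (hn : 6 ≤ n) (hm : 2 ≤ m) :
    c k₁ k₅ = 5 * (n - 2) * (n - 1) * n / (2 * (2 * n - 5) * (2 * n - 3) * (2 * n - 1)) ∧
    c k₂ k₅ = 3 * (n - 3) * (n - 2) * (n - 1) * n / ((2 * n - 7) * (2 * n - 5) * (2 * n - 1)) ∧
    c k₃ k₅ = 2 * (n - 4) * (n - 3) * (n - 2) * (n - 1) * n / ((2 * n - 9) * (2 * n - 5) * (2 * n - 3)) ∧
    c k₅ k₅ = 4 * (n - 5) * (n - 4) * (n - 3) * (n - 2) * (n - 1) * n /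
      (3 * (2 * n - 9) * (2 * n - 7) * (2 * n - 5)) := by
  have e₁₁ := hc.column_one h₁ ((card_le_of_part_eq_zero (i := 2) (by rw [h₁]; rfl)).trans hm)
  obtain ⟨e₁₂, e₂₂⟩ := hc.column_two h₁ h₂ (by omega) hm
  obtain ⟨e₁₃, e₂₃, e₃₃⟩ := hc.column_three h₁ h₂ h₃ (by omega) hm
  have e₂₁ := hc.eq_zero_of_triple h₂ h₁ (by omega)
  have e₃₁ := hc.eq_zero_of_triple h₃ h₁ (by omega)
  have e₃₂ := hc.eq_zero_of_triple h₃ h₂ (by omega)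
  obtain ⟨a, rfl⟩ := Nat.exists_eq_add_of_le' (show 3 ≤ n by omega)
  simp only [Nat.reduceSubDiff, Nat.add_sub_cancel] at h₂ h₃ h₅
  obtain ⟨N, hN⟩ : ∃ N : ℝ, N = ((a + 3 : ℕ) : ℝ) := ⟨_, rfl⟩
  rw [← hN] at e₁₂ e₂₂ e₁₃ e₂₃ e₃₃
  have hm' : k₅.parts.card ≤ m := (card_le_of_part_eq_zero (by rw [h₅]; rfl)).trans hm
  have hs := hc.sum_mul_factorial hm' h₅ {k₁, k₂, k₃, k₅} fun κ hκ => by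
    obtain ⟨x, y, z, hx, h⟩ := exists_triple_of_dominates hκ h₅
    have : x = a + 3 ∧ y = 0 ∧ z = 0 ∨
        x = a + 2 ∧ y = 1 ∧ z = 0 ∨
        x = a + 1 ∧ y = 2 ∧ z = 0 ∨
        x = a ∧ y = 3 ∧ z = 0 := by omega
    rcases this with ⟨rfl, rfl, rfl⟩ | ⟨rfl, rfl, rfl⟩ | ⟨rfl, rfl, rfl⟩ | ⟨rfl, rfl, rfl⟩
    · simp [eq_of_triple hx h₁ rfl rfl rfl]
    · simp [eq_of_triple hx h₂ rfl rfl rfl]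
    · simp [eq_of_triple hx h₃ rfl rfl rfl]
    · simp [eq_of_triple hx h₅ rfl rfl rfl]
  rw [Finset.sum_insert (by simp [ne_of_triple h₁ h₂, ne_of_triple h₁ h₃, ne_of_triple h₁ h₅]),
    Finset.sum_insert (by simp [ne_of_triple h₂ h₃, ne_of_triple h₂ h₅]),
    Finset.sum_pair (ne_of_triple h₃ h₅ (by omega))] at hs
  have hr₁ := hc.recurrence_three k₁ h₁ h₂ h₃ h₅ hm'
  have hr₂ := hc.recurrence_three k₂ h₁ h₂ h₃ h₅ hm'
  have hr₃ := hc.recurrence_three k₃ h₁ h₂ h₃ h₅ hm'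
  rw [e₁₁, e₁₂, e₁₃, rho_eq_of_triple h₁] at hr₁
  rw [e₂₁, e₂₂, e₂₃, rho_eq_of_triple h₂] at hr₂
  rw [e₃₁, e₃₂, e₃₃, rho_eq_of_triple h₃] at hr₃
  have hf : (a.factorial : ℝ) ≠ 0 := by positivity
  replace hs : c k₁ k₅ + (c k₂ k₅ + (c k₃ k₅ + (c k₅ k₅))) =
      (a + 3) * (a + 2) * (a + 1) / 6 := by
    apply mul_right_cancel₀ hf
    push_cast [Nat.factorial] at hs
    linear_combination hs / 6
  have ha : (a : ℝ) = N - 3 := by rw [hN]; push_cast; ring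
  have hN6 : (6 : ℝ) ≤ N := by rw [hN]; exact_mod_cast hn
  push_cast at hr₁ hr₂ hr₃
  rw [← hN]
  rw [ha] at hr₁ hr₂ hr₃ hs
  have d1 : N * 2 - 1 ≠ 0 := by linarith
  have d1' : 2 * N - 1 ≠ 0 := by linarith
  have d3 : N * 2 - 3 ≠ 0 := by linarith
  have d3' : 2 * N - 3 ≠ 0 := by linarith
  have d5 : N * 2 - 5 ≠ 0 := by linarith
  have d5' : 2 * N - 5 ≠ 0 := by linarith
  have d7 : N * 2 - 7 ≠ 0 := by linarith
  have d7' : 2 * N - 7 ≠ 0 := by linarith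
  have d9 : N * 2 - 9 ≠ 0 := by linarith
  have d9' : 2 * N - 9 ≠ 0 := by linarith
  have e₁ : c k₁ k₅ =
      5 * (N - 2) * (N - 1) * N / (2 * (2 * N - 5) * (2 * N - 3) * (2 * N - 1)) := by
    have d : 2 * N - 5 ≠ 0 := by linarith
    apply mul_left_cancel₀ d
    rw [show (2 * N - 5) * c k₁ k₅ =
      (N +
      (N - 2) * (N / (2 * N - 1)) +
      (N - 4) * (3 * (N - 1) * N / (2 * (2 * N - 3) * (2 * N - 1)))) / 3 by
      linear_combination hr₁ / 3]
    field_simp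
    ring
  have e₂ : c k₂ k₅ =
      3 * (N - 3) * (N - 2) * (N - 1) * N / ((2 * N - 7) * (2 * N - 5) * (2 * N - 1)) := by
    have d : 2 * N - 7 ≠ 0 := by linarith
    apply mul_left_cancel₀ d
    rw [show (2 * N - 7) * c k₂ k₅ =
      ((N - 2) * (2 * (N - 1) * N / (2 * N - 1)) +
      (N - 4) * (2 * (N - 2) * (N - 1) * N / ((2 * N - 5) * (2 * N - 1)))) / 2 by
      linear_combination hr₂ / 2]
    field_simp
    ring
  have e₃ : c k₃ k₅ =
      2 * (N - 4) * (N - 3) * (N - 2) * (N - 1) * N / ((2 * N - 9) * (2 * N - 5) * (2 * N - 3)) := by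
    have d : 2 * N - 9 ≠ 0 := by linarith
    apply mul_left_cancel₀ d
    rw [show (2 * N - 9) * c k₃ k₅ =
      (N - 4) * (2 * (N - 3) * (N - 2) * (N - 1) * N / ((2 * N - 5) * (2 * N - 3))) by
      linear_combination hr₃]
    field_simp
  refine ⟨e₁, e₂, e₃, ?_⟩
  rw [show c k₅ k₅ = N * (N - 1) * (N - 2) / 6 - c k₁ k₅ - c k₂ k₅ - c k₃ k₅ by
    linear_combination hs, e₁, e₂, e₃]
  field_simp
  ring

/-- The column sum for `(n-3,2,1)`, solved for the diagonal entry; `N (N - 1) (N - 2) / 2` is the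
multinomial coefficient. -/
theorem multinomial_sub_column_six {N : ℝ} (hN : 6 ≤ N) :
    N * (N - 1) * (N - 2) / 2 - 3 * (N - 2) * (N - 1) * N / (2 * (2 * N - 5) * (2 * N - 3) * (2 * N - 1)) -
      (N - 2) * N * (5 * N ^ 2 - 20 * N + 11) / ((2 * N - 7) * (2 * N - 5) * (2 * N - 1)) -
      2 * (N - 3) * (N - 1) * N * (5 * N ^ 2 - 30 * N + 36) /
      (3 * (2 * N - 9) * (2 * N - 5) * (2 * N - 3)) -
      2 * (N - 3) * (N - 2) * N / (3 * (2 * N - 7)) -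
      4 * (N - 5) * (N - 4) * (N - 3) * (N - 2) * (N - 1) * N /
      (5 * (2 * N - 9) * (2 * N - 7) * (2 * N - 5)) =
    4 * (N - 4) * (N - 3) * (N - 1) * N / (5 * (2 * N - 7)) := by
  have d1 : N * 2 - 1 ≠ 0 := by linarith
  have d1' : 2 * N - 1 ≠ 0 := by linarith
  have d3 : N * 2 - 3 ≠ 0 := by linarith
  have d3' : 2 * N - 3 ≠ 0 := by linarith
  have d5 : N * 2 - 5 ≠ 0 := by linarith
  have d5' : 2 * N - 5 ≠ 0 := by linarith
  have d7 : N * 2 - 7 ≠ 0 := by linarith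
  have d7' : 2 * N - 7 ≠ 0 := by linarith
  have d9 : N * 2 - 9 ≠ 0 := by linarith
  have d9' : 2 * N - 9 ≠ 0 := by linarith
  field_simp
  ring

-- The gaps of `ρ` are `2 (3n - 5)`, `4n - 9`, `2 (n - 2)`, `2n - 7` and `5`; the factors `3n - 5`,
-- `4n - 9` and `n - 2` cancel from the denominators.
set_option maxHeartbeats 400000 in
theorem column_six (hc : IsCoefficients m n c)
    (h₁ : part k₁ = triple n 0 0)
    (h₂ : part k₂ = triple (n - 1) 1 0)
    (h₃ : part k₃ = triple (n - 2) 2 0)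
    (h₄ : part k₄ = triple (n - 2) 1 1)
    (h₅ : part k₅ = triple (n - 3) 3 0)
    (h₆ : part k₆ = triple (n - 3) 2 1)
    (hn : 6 ≤ n) (hm : 3 ≤ m) :
    c k₁ k₆ = 3 * (n - 2) * (n - 1) * n / (2 * (2 * n - 5) * (2 * n - 3) * (2 * n - 1)) ∧
    c k₂ k₆ = (n - 2) * n * (5 * n ^ 2 - 20 * n + 11) / ((2 * n - 7) * (2 * n - 5) * (2 * n - 1)) ∧
    c k₃ k₆ = 2 * (n - 3) * (n - 1) * n * (5 * n ^ 2 - 30 * n + 36) /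
      (3 * (2 * n - 9) * (2 * n - 5) * (2 * n - 3)) ∧
    c k₄ k₆ = 2 * (n - 3) * (n - 2) * n / (3 * (2 * n - 7)) ∧
    c k₅ k₆ = 4 * (n - 5) * (n - 4) * (n - 3) * (n - 2) * (n - 1) * n /
      (5 * (2 * n - 9) * (2 * n - 7) * (2 * n - 5)) ∧
    c k₆ k₆ = 4 * (n - 4) * (n - 3) * (n - 1) * n / (5 * (2 * n - 7)) := by
  obtain ⟨e₁₂, e₂₂⟩ := hc.column_two h₁ h₂ (by omega) (by omega)
  obtain ⟨e₁₃, e₂₃, e₃₃⟩ := hc.column_three h₁ h₂ h₃ (by omega) (by omega)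
  obtain ⟨e₁₄, e₂₄, e₃₄, e₄₄⟩ := hc.column_four h₁ h₂ h₃ h₄ hn hm
  obtain ⟨e₁₅, e₂₅, e₃₅, e₅₅⟩ := hc.column_five h₁ h₂ h₃ h₅ hn (by omega)
  have e₃₂ := hc.eq_zero_of_triple h₃ h₂ (by omega)
  have e₄₂ := hc.eq_zero_of_triple h₄ h₂ (by omega)
  have e₄₃ := hc.eq_zero_of_triple h₄ h₃ (by omega)
  have e₄₅ := hc.eq_zero_of_triple h₄ h₅ (by omega)
  have e₅₂ := hc.eq_zero_of_triple h₅ h₂ (by omega)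
  have e₅₃ := hc.eq_zero_of_triple h₅ h₃ (by omega)
  have e₅₄ := hc.eq_zero_of_triple h₅ h₄ (by omega)
  obtain ⟨a, rfl⟩ := Nat.exists_eq_add_of_le' (show 3 ≤ n by omega)
  simp only [Nat.reduceSubDiff, Nat.add_sub_cancel] at h₂ h₃ h₄ h₅ h₆
  obtain ⟨N, hN⟩ : ∃ N : ℝ, N = ((a + 3 : ℕ) : ℝ) := ⟨_, rfl⟩
  rw [← hN] at e₁₂ e₂₂ e₁₃ e₂₃ e₃₃ e₁₄ e₂₄ e₃₄ e₄₄ e₁₅ e₂₅ e₃₅ e₅₅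
  have hm' : k₆.parts.card ≤ m := (card_le_of_part_eq_zero (by rw [h₆]; rfl)).trans hm
  have hs := hc.sum_mul_factorial hm' h₆ {k₁, k₂, k₃, k₄, k₅, k₆} fun κ hκ => by
    obtain ⟨x, y, z, hx, h⟩ := exists_triple_of_dominates hκ h₆
    have : x = a + 3 ∧ y = 0 ∧ z = 0 ∨
        x = a + 2 ∧ y = 1 ∧ z = 0 ∨
        x = a + 1 ∧ y = 2 ∧ z = 0 ∨
        x = a + 1 ∧ y = 1 ∧ z = 1 ∨
        x = a ∧ y = 3 ∧ z = 0 ∨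
        x = a ∧ y = 2 ∧ z = 1 := by omega
    rcases this with ⟨rfl, rfl, rfl⟩ | ⟨rfl, rfl, rfl⟩ | ⟨rfl, rfl, rfl⟩ | ⟨rfl, rfl, rfl⟩ | ⟨rfl, rfl, rfl⟩ | ⟨rfl, rfl, rfl⟩
    · simp [eq_of_triple hx h₁ rfl rfl rfl]
    · simp [eq_of_triple hx h₂ rfl rfl rfl]
    · simp [eq_of_triple hx h₃ rfl rfl rfl]
    · simp [eq_of_triple hx h₄ rfl rfl rfl]
    · simp [eq_of_triple hx h₅ rfl rfl rfl]
    · simp [eq_of_triple hx h₆ rfl rfl rfl]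
  rw [Finset.sum_insert (by simp [ne_of_triple h₁ h₂, ne_of_triple h₁ h₃, ne_of_triple h₁ h₄, ne_of_triple h₁ h₅, ne_of_triple h₁ h₆]),
    Finset.sum_insert (by simp [ne_of_triple h₂ h₃, ne_of_triple h₂ h₄, ne_of_triple h₂ h₅, ne_of_triple h₂ h₆]),
    Finset.sum_insert (by simp [ne_of_triple h₃ h₄, ne_of_triple h₃ h₅, ne_of_triple h₃ h₆]),
    Finset.sum_insert (by simp [ne_of_triple h₄ h₅, ne_of_triple h₄ h₆]),
    Finset.sum_pair (ne_of_triple h₅ h₆ (by omega))] at hs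
  have hr₁ := hc.recurrence_two_one k₁ h₂ h₃ h₄ h₅ h₆ hm'
  have hr₂ := hc.recurrence_two_one k₂ h₂ h₃ h₄ h₅ h₆ hm'
  have hr₃ := hc.recurrence_two_one k₃ h₂ h₃ h₄ h₅ h₆ hm'
  have hr₄ := hc.recurrence_two_one k₄ h₂ h₃ h₄ h₅ h₆ hm'
  have hr₅ := hc.recurrence_two_one k₅ h₂ h₃ h₄ h₅ h₆ hm'
  rw [e₁₂, e₁₃, e₁₄, e₁₅, rho_eq_of_triple h₁] at hr₁
  rw [e₂₂, e₂₃, e₂₄, e₂₅, rho_eq_of_triple h₂] at hr₂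
  rw [e₃₂, e₃₃, e₃₄, e₃₅, rho_eq_of_triple h₃] at hr₃
  rw [e₄₂, e₄₃, e₄₄, e₄₅, rho_eq_of_triple h₄] at hr₄
  rw [e₅₂, e₅₃, e₅₄, e₅₅, rho_eq_of_triple h₅] at hr₅
  have hf : (a.factorial : ℝ) ≠ 0 := by positivity
  replace hs : c k₁ k₆ + (c k₂ k₆ + (c k₃ k₆ + (c k₄ k₆ + (c k₅ k₆ + (c k₆ k₆))))) =
      (a + 3) * (a + 2) * (a + 1) / 2 := by
    apply mul_right_cancel₀ hf
    push_cast [Nat.factorial] at hs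
    linear_combination hs / 2
  have ha : (a : ℝ) = N - 3 := by rw [hN]; push_cast; ring
  have hN6 : (6 : ℝ) ≤ N := by rw [hN]; exact_mod_cast hn
  push_cast at hr₁ hr₂ hr₃ hr₄ hr₅
  rw [← hN]
  rw [ha] at hr₁ hr₂ hr₃ hr₄ hr₅ hs
  have d1 : N * 2 - 1 ≠ 0 := by linarith
  have d1' : 2 * N - 1 ≠ 0 := by linarith
  have d3 : N * 2 - 3 ≠ 0 := by linarith
  have d3' : 2 * N - 3 ≠ 0 := by linarith
  have d5 : N * 2 - 5 ≠ 0 := by linarith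
  have d5' : 2 * N - 5 ≠ 0 := by linarith
  have d7 : N * 2 - 7 ≠ 0 := by linarith
  have d7' : 2 * N - 7 ≠ 0 := by linarith
  have d9 : N * 2 - 9 ≠ 0 := by linarith
  have d9' : 2 * N - 9 ≠ 0 := by linarith
  have e₁ : c k₁ k₆ =
      3 * (N - 2) * (N - 1) * N / (2 * (2 * N - 5) * (2 * N - 3) * (2 * N - 1)) := by
    have d : 3 * N - 5 ≠ 0 := by linarith
    apply mul_left_cancel₀ d
    rw [show (3 * N - 5) * c k₁ k₆ =
      ((N - 1) * (N / (2 * N - 1)) +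
      (N - 2) * (3 * (N - 1) * N / (2 * (2 * N - 3) * (2 * N - 1))) +
      (N - 3) * ((N - 1) * N / ((2 * N - 3) * (2 * N - 1))) +
      3 * (5 * (N - 2) * (N - 1) * N / (2 * (2 * N - 5) * (2 * N - 3) * (2 * N - 1)))) / 2 by
      linear_combination hr₁ / 2]
    field_simp
    ring
  have e₂ : c k₂ k₆ =
      (N - 2) * N * (5 * N ^ 2 - 20 * N + 11) / ((2 * N - 7) * (2 * N - 5) * (2 * N - 1)) := by
    have d : 4 * N - 9 ≠ 0 := by linarith
    apply mul_left_cancel₀ d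
    rw [show (4 * N - 9) * c k₂ k₆ =
      (N - 1) * (2 * (N - 1) * N / (2 * N - 1)) +
      (N - 2) * (2 * (N - 2) * (N - 1) * N / ((2 * N - 5) * (2 * N - 1))) +
      (N - 3) * (2 * N * (2 * N ^ 2 - 6 * N + 3) / ((2 * N - 5) * (2 * N - 1))) +
      3 * (3 * (N - 3) * (N - 2) * (N - 1) * N / ((2 * N - 7) * (2 * N - 5) * (2 * N - 1))) by
      linear_combination hr₂]
    field_simp
    ring
  have e₃ : c k₃ k₆ =
      2 * (N - 3) * (N - 1) * N * (5 * N ^ 2 - 30 * N + 36) / (3 * (2 * N - 9) * (2 * N - 5) * (2 * N - 3)) := by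
    have d : N - 2 ≠ 0 := by linarith
    apply mul_left_cancel₀ d
    rw [show (N - 2) * c k₃ k₆ =
      ((N - 2) * (2 * (N - 3) * (N - 2) * (N - 1) * N / ((2 * N - 5) * (2 * N - 3))) +
      (N - 3) * (4 * (N - 3) * (N - 2) * (N - 1) * N / (3 * (2 * N - 5) * (2 * N - 3))) +
      3 * (2 * (N - 4) * (N - 3) * (N - 2) * (N - 1) * N / ((2 * N - 9) * (2 * N - 5) * (2 * N - 3)))) / 2 by
      linear_combination hr₃ / 2]
    field_simp
    ring
  have e₄ : c k₄ k₆ =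
      2 * (N - 3) * (N - 2) * N / (3 * (2 * N - 7)) := by
    have d : 2 * N - 7 ≠ 0 := by linarith
    apply mul_left_cancel₀ d
    rw [show (2 * N - 7) * c k₄ k₆ =
      (N - 3) * (2 / 3 * (N - 2) * N) by
      linear_combination hr₄]
    field_simp
  have e₅ : c k₅ k₆ =
      4 * (N - 5) * (N - 4) * (N - 3) * (N - 2) * (N - 1) * N / (5 * (2 * N - 9) * (2 * N - 7) * (2 * N - 5)) := by
    have d : (5 : ℝ) ≠ 0 := by norm_num
    apply mul_left_cancel₀ d
    rw [show (5) * c k₅ k₆ =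
      3 * (4 * (N - 5) * (N - 4) * (N - 3) * (N - 2) * (N - 1) * N / (3 * (2 * N - 9) * (2 * N - 7) * (2 * N - 5))) by
      linear_combination hr₅]
    field_simp
  refine ⟨e₁, e₂, e₃, e₄, e₅, ?_⟩
  rw [show c k₆ k₆ = N * (N - 1) * (N - 2) / 2 - c k₁ k₆ - c k₂ k₆ - c k₃ k₆ - c k₄ k₆ - c k₅ k₆ by
    linear_combination hs, e₁, e₂, e₃, e₄, e₅]
  exact multinomial_sub_column_six hN6

end IsCoefficients

/-! ### Assembling the table -/

theorem shape_triple_one {a : ℕ} (ha : a ≠ 0) : shape 3 (triple a 0 0) = {a} := by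
  simp [shape, triple, Multiset.range_succ, ha]

theorem shape_triple_two {a b : ℕ} (ha : a ≠ 0) (hb : b ≠ 0) :
    shape 3 (triple a b 0) = {a, b} := by
  rw [Multiset.pair_comm]
  simp [shape, triple, Multiset.range_succ, Multiset.filter_singleton, ha, hb]

theorem shape_triple_three {a b d : ℕ} (ha : a ≠ 0) (hb : b ≠ 0) (hd : d ≠ 0) :
    shape 3 (triple a b d) = {a, b, d} := by
  have h : ({a, b, d} : Multiset ℕ) = {d, b, a} := by
    simp only [Multiset.insert_eq_cons, ← Multiset.singleton_add]
    abel
  rw [h]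
  simp [shape, triple, Multiset.range_succ, Multiset.filter_singleton, ha, hb, hd]

end Zonal
end

theorem theorem5p2 :
    (∀ n m : ℕ, 2 ≤ n → 2 ≤ m → ∀ κ : n.Partition, κ.parts = {n - 1, 1} →
      Zonal.zonalCoeff m κ κ = 2 * (n : ℝ) * (n - 1) / (2 * n - 1)) ∧
    (∀ n m : ℕ, 4 ≤ n → 2 ≤ m → ∀ κ l : n.Partition,
      κ.parts = {n - 1, 1} → l.parts = {n - 2, 2} →
      Zonal.zonalCoeff m κ l =
        2 * (n : ℝ) * (n - 1) * (n - 2) / ((2 * n - 1) * (2 * n - 5))) ∧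
    (∀ n m : ℕ, 4 ≤ n → 2 ≤ m → ∀ κ : n.Partition, κ.parts = {n - 2, 2} →
      Zonal.zonalCoeff m κ κ =
        2 * (n : ℝ) * (n - 1) * (n - 2) * (n - 3) / ((2 * n - 3) * (2 * n - 5))) ∧
    (∀ n m : ℕ, 6 ≤ n → ∀ p : Fin 6 → n.Partition,
      (∀ i, (p i).parts = Zonal.cornerParts n i) →
      ∀ i j, (p j).parts.card ≤ m →
        Zonal.zonalCoeff m (p i) (p j) = Zonal.cornerTable n i j) := by
  open Zonal in
  refine ⟨fun n m hn hm k₂ hk₂ => ?_, fun n m hn hm k₂ k₃ hk₂ hk₃ => ?_,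
    fun n m hn hm k₃ hk₃ => ?_, fun n m hn p hp i j hj => ?_⟩
  · obtain ⟨c, hc, hz⟩ := exists_isCoefficients m n
    -- The partition `(n)` is not part of the claim, but it contributes to the column sum.
    obtain ⟨k₁, h₁⟩ := exists_part_eq_triple (n := n) (Nat.zero_le n) le_rfl rfl
    have h₂ : part k₂ = triple (n - 1) 1 0 := part_eq_triple (by omega) (by omega)
      (by rw [hk₂, shape_triple_two (by omega) (by omega)])
    rw [hz _ _ (by simpa [hk₂] using hm), (hc.column_two h₁ h₂ hn hm).2]
    ring
  · obtain ⟨c, hc, hz⟩ := exists_isCoefficients m n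
    obtain ⟨k₁, h₁⟩ := exists_part_eq_triple (n := n) (Nat.zero_le n) le_rfl rfl
    have h₂ : part k₂ = triple (n - 1) 1 0 := part_eq_triple (by omega) (by omega)
      (by rw [hk₂, shape_triple_two (by omega) (by omega)])
    have h₃ : part k₃ = triple (n - 2) 2 0 := part_eq_triple (by omega) (by omega)
      (by rw [hk₃, shape_triple_two (by omega) (by omega)])
    rw [hz _ _ (by simpa [hk₃] using hm), (hc.column_three h₁ h₂ h₃ hn hm).2.1]
    ring
  · obtain ⟨c, hc, hz⟩ := exists_isCoefficients m n
    obtain ⟨k₁, h₁⟩ := exists_part_eq_triple (n := n) (Nat.zero_le n) le_rfl rfl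
    obtain ⟨k₂, h₂⟩ := exists_part_eq_triple (n := n) (a := n - 1) (b := 1) (d := 0) (by omega)
      (by omega) (by omega)
    have h₃ : part k₃ = triple (n - 2) 2 0 := part_eq_triple (by omega) (by omega)
      (by rw [hk₃, shape_triple_two (by omega) (by omega)])
    rw [hz _ _ (by simpa [hk₃] using hm), (hc.column_three h₁ h₂ h₃ hn hm).2.2]
    ring
  · obtain ⟨c, hc, hz⟩ := exists_isCoefficients m n
    rw [hz _ _ hj]
    have h₁ : part (p 0) = triple n 0 0 := part_eq_triple (by omega) (by omega)
      ((hp 0).trans (shape_triple_one (by omega)).symm)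
    have h₂ : part (p 1) = triple (n - 1) 1 0 := part_eq_triple (by omega) (by omega)
      ((hp 1).trans (shape_triple_two (by omega) (by omega)).symm)
    have h₃ : part (p 2) = triple (n - 2) 2 0 := part_eq_triple (by omega) (by omega)
      ((hp 2).trans (shape_triple_two (by omega) (by omega)).symm)
    have h₄ : part (p 3) = triple (n - 2) 1 1 := part_eq_triple (by omega) (by omega)
      ((hp 3).trans (shape_triple_three (by omega) (by omega) (by omega)).symm)
    have h₅ : part (p 4) = triple (n - 3) 3 0 := part_eq_triple (by omega) (by omega)
      ((hp 4).trans (shape_triple_two (by omega) (by omega)).symm)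
    have h₆ : part (p 5) = triple (n - 3) 2 1 := part_eq_triple (by omega) (by omega)
      ((hp 5).trans (shape_triple_three (by omega) (by omega) (by omega)).symm)
    -- For each column this becomes, by computation, the numerical bound on `m` that the column
    -- lemma requires.
    have hcard := hj
    rw [hp j] at hcard
    match j with
    | 0 =>
      match i with
      | 0 => exact hc.column_one h₁ hj
      | 1 => exact hc.eq_zero_of_triple h₂ h₁ (by omega)
      | 2 => exact hc.eq_zero_of_triple h₃ h₁ (by omega)
      | 3 => exact hc.eq_zero_of_triple h₄ h₁ (by omega)
      | 4 => exact hc.eq_zero_of_triple h₅ h₁ (by omega)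
      | 5 => exact hc.eq_zero_of_triple h₆ h₁ (by omega)
    | 1 =>
      have h := hc.column_two h₁ h₂ (by omega) hcard
      match i with
      | 0 => exact h.1
      | 1 => exact h.2
      | 2 => exact hc.eq_zero_of_triple h₃ h₂ (by omega)
      | 3 => exact hc.eq_zero_of_triple h₄ h₂ (by omega)
      | 4 => exact hc.eq_zero_of_triple h₅ h₂ (by omega)
      | 5 => exact hc.eq_zero_of_triple h₆ h₂ (by omega)
    | 2 =>
      have h := hc.column_three h₁ h₂ h₃ (by omega) hcard
      match i with
      | 0 => exact h.1
      | 1 => exact h.2.1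
      | 2 => exact h.2.2
      | 3 => exact hc.eq_zero_of_triple h₄ h₃ (by omega)
      | 4 => exact hc.eq_zero_of_triple h₅ h₃ (by omega)
      | 5 => exact hc.eq_zero_of_triple h₆ h₃ (by omega)
    | 3 =>
      have h := hc.column_four h₁ h₂ h₃ h₄ hn hcard
      match i with
      | 0 => exact h.1
      | 1 => exact h.2.1
      | 2 => exact h.2.2.1
      | 3 => exact h.2.2.2
      | 4 => exact hc.eq_zero_of_triple h₅ h₄ (by omega)
      | 5 => exact hc.eq_zero_of_triple h₆ h₄ (by omega)
    | 4 =>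
      have h := hc.column_five h₁ h₂ h₃ h₅ hn hcard
      match i with
      | 0 => exact h.1
      | 1 => exact h.2.1
      | 2 => exact h.2.2.1
      | 3 => exact hc.eq_zero_of_triple h₄ h₅ (by omega)
      | 4 => exact h.2.2.2
      | 5 => exact hc.eq_zero_of_triple h₆ h₅ (by omega)
    | 5 =>
      have h := hc.column_six h₁ h₂ h₃ h₄ h₅ h₆ hn hcard
      match i with
      | 0 => exact h.1
      | 1 => exact h.2.1
      | 2 => exact h.2.2.1
      | 3 => exact h.2.2.2.1
      | 4 => exact h.2.2.2.2.1
      | 5 => exact h.2.2.2.2.2
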